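/- **Theorem 1.1 (Existence).** Let $H^6_{per}([0,2\pi],\mathbb R)$ be the space of real $2\pi$-periodic functions with weak derivatives up to order six in $L^2([0,2\pi])$ (identified with their continuous representatives), with norm $\|u\|_{H^6}^2=\sum_{j\le 6}\int_0^{2\pi}|\partial_\xi^j u|^2\,d\xi$. Fix $s\in(-\sqrt{27/2},\sqrt{27/2})$. For $\varepsilon>0$ and $\omega\in[-\tfrac12,\tfrac12]$ put $k=\sqrt{1+2\omega\varepsilon}$ and consider, for a constant $q\in\mathbb R$, the equation $$-k^2\bigl[-(1+k^2\partial_\xi^2)^2u+\varepsilon^2u-su^2-u^3\bigr]=q .\qquad(1.5)$$ There exist $\varepsilon_0>0$, $\delta>0$ and $C$, depending only on $s$, such that for all $\varepsilon\in(0,\varepsilon_0)$ and all $\omega\in[-\tfrac12,\tfrac12]$: * if $|\omega|<\tfrac12$, there is exactly one $\tilde u=\tilde u_{\varepsilon,\omega,s}\in H^6_{per}([0,2\pi],\mathbb R)$ with $\|\tilde u\|_{H^6}<\delta$ which has zero mean, $\int_0^{2\pi}\tilde u\,d\xi=0$, solves (1.5) for some constant $q$ (equivalently, solves $-k^2\partial_\xi^2[-(1+k^2\partial_\xi^2)^2u+\varepsilon^2u-su^2-u^3]=0$),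 is even in $\xi$, and satisfies $\tilde u(0)>0$; * if $\omega=\pm\tfrac12$, the only even $\tilde u\in H^6_{per}([0,2\pi],\mathbb R)$ of zero mean with $\|\tilde u\|_{H^6}<\delta$ which solves (1.5) for some constant $q$ is $\tilde u\equiv0$. In both cases $$\Bigl\|\tilde u-6\sqrt{\tfrac{1-4\omega^2}{27-2s^2}}\,\cos\xi\;\varepsilon-\Bigl(-32\,\omega s^2\sqrt{\tfrac{1-4\omega^2}{(27-2s^2)^3}}\,\cos\xi-\tfrac{2s(1-4\omega^2)}{27-2s^2}\cos2\xi\Bigr)\varepsilon^2\Bigr\|_{H^6}\le C\varepsilon^3 .$$ -/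

import Mathlib

noncomputable section

namespace PatternCL

open MeasureTheory

/-- `v` is the `j`-th weak derivative of `u` on the circle `ℝ / 2πℤ`: integration by parts holds
against every smooth `2π`-periodic test function. -/
def HasWeakDeriv (j : ℕ) (u v : ℝ → ℝ) : Prop :=
  ∀ φ : ℝ → ℝ, ContDiff ℝ (⊤ : ℕ∞) φ → Function.Periodic φ (2 * Real.pi) →
    ∫ x in (0 : ℝ)..(2 * Real.pi), u x * iteratedDeriv j φ x =
      (-1) ^ j * ∫ x in (0 : ℝ)..(2 * Real.pi), v x * φ x

/-- `v` is a function in `L²_per([0, 2π], ℝ)`. -/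
def MemL2per (v : ℝ → ℝ) : Prop :=
  Function.Periodic v (2 * Real.pi) ∧
    MemLp v 2 (volume.restrict (Set.Ioc 0 (2 * Real.pi)))

/-- `u` is (the continuous representative of) an element of `H⁶_per([0, 2π], ℝ)`: it is
`2π`-periodic and its weak derivatives up to order six are in `L²`. The continuous representative,
which exists and is unique by Sobolev embedding, gives `u 0` a meaning. -/
structure MemH6per (u : ℝ → ℝ) : Prop where
  continuous : Continuous u
  periodic : Function.Periodic u (2 * Real.pi)
  weakDeriv : ∀ j ≤ 6, ∃ v, MemL2per v ∧ HasWeakDeriv j u v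

open Classical in
/-- The `j`-th weak derivative of `u`, an `L²_per` function that is determined almost everywhere
(and `0` if `u` has no such derivative). -/
def weakDeriv (j : ℕ) (u : ℝ → ℝ) : ℝ → ℝ :=
  if h : ∃ v, MemL2per v ∧ HasWeakDeriv j u v then h.choose else 0

/-- The norm of `H⁶_per([0, 2π], ℝ)`, `(∑_{j ≤ 6} ∫₀^{2π} |∂ʲu|²)^{1/2}`. -/
def h6norm (u : ℝ → ℝ) : ℝ :=
  √(∑ j ∈ Finset.range 7, ∫ x in (0 : ℝ)..(2 * Real.pi), (weakDeriv j u x) ^ 2)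

/-- The operator `1 + k² ∂_ξ²`. -/
def onePlus (k : ℝ) (u : ℝ → ℝ) : ℝ → ℝ :=
  fun ξ => u ξ + k ^ 2 * weakDeriv 2 u ξ

/-- The equation `-k² [-(1 + k² ∂_ξ²)² u + ε² u - s u² - u³] = q`, almost everywhere. -/
def SolvesProfile (ε k s q : ℝ) (u : ℝ → ℝ) : Prop :=
  ∀ᵐ ξ ∂(volume.restrict (Set.Ioc 0 (2 * Real.pi))),
    -k ^ 2 * (-(onePlus k (onePlus k u) ξ) + ε ^ 2 * u ξ - s * u ξ ^ 2 - u ξ ^ 3) = q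

/-- `u` is an even `H⁶_per` function of mean zero that solves the profile equation for some
value of the integration constant `q`. -/
def IsEvenProfile (ε k s : ℝ) (u : ℝ → ℝ) : Prop :=
  MemH6per u ∧ (∀ ξ, u (-ξ) = u ξ) ∧ ∫ ξ in (0 : ℝ)..(2 * Real.pi), u ξ = 0 ∧
    ∃ q : ℝ, SolvesProfile ε k s q u

/-- The explicit part, up to order `ε²`, of the expansion of the solution. -/
def expansion (ε ω s ξ : ℝ) : ℝ :=
  6 * √((1 - 4 * ω ^ 2) / (27 - 2 * s ^ 2)) * Real.cos ξ * ε +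
    (-32 * ω * s ^ 2 * √((1 - 4 * ω ^ 2) / (27 - 2 * s ^ 2) ^ 3) * Real.cos ξ -
      2 * s * (1 - 4 * ω ^ 2) / (27 - 2 * s ^ 2) * Real.cos (2 * ξ)) * ε ^ 2

end PatternCL

end

noncomputable section

namespace PatternCL

open MeasureTheory

/-! Tested against cos(nξ) with n ≥ 1, the equation for an even `u` reads λₙaₙ + (n-th coefficient
of su² + u³) = 0 with λₙ = (1 - k²n²)² - ε², while the mode n = 0 only fixes `q`
(`exists_solvesProfile_iff`). Since k² = 1 + 2ωε, λ₁ = -ε²(1 - 4ω²) is small, whereas λₙ ≥ n⁴/4 for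
n ≥ 2 (`symbol_ge`). Mode one is the only critical one, and the proof is a Lyapunov–Schmidt
reduction to its amplitude A.

The reduction runs in the weighted ℓ¹ space `CosSeq` of cosine coefficients. Its weight (1 + n)² is
submultiplicative, so the nonlinearity is a polynomial in a Banach algebra. Even `H⁶` functions of
mean zero embed into it (`exists_cosSeq`), and inverting λₙ gains four powers of n, which together
with the weight give back six derivatives (`smooth_diag`). With u = A(cos ξ + A w), the modes n ≥ 2
become a fixed point equation for w, a contraction that is Lipschitz in A (`norm_step_sub_le`).
Conversely, every small solution has this form (`exists_ansatz`).

Mode one leaves A³h(A) = ε²(1 - 4ω²)A, because cos² has no mode one. Parity removes the first-order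
term of h, so h = 3/4 - s²/(2λ₂) + O(A²) (`abs_ampl_sub_leading_le`). As λ₂ is near 9, h is close to
(27 - 2s²)/36, which the range of s makes positive. The equation A²h(A) = ε²(1 - 4ω²) has a solution
A ≥ 0 by the intermediate value theorem (`exists_amplitude`). A positive solution is unique, since h
is Lipschitz and bounded below (`amplitude_unique`). The sign of A is the sign of u(0), and at ω =
±1/2 only A = 0 remains.

Expanding 1/λ₂ to first order in ωε gives h up to O(ε²), hence the first two modes up to O(ε³). What
is left is O(A³) in `H⁶` (`h6norm_sub_expansion_le`). -/

/-! ### Cosine coefficients -/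

/-- The cosine coefficient `π⁻¹ ∫₀^{2π} f(x) cos(nx) dx`. -/
def cosCoeff (n : ℕ) (f : ℝ → ℝ) : ℝ :=
  (1 / Real.pi) * ∫ x in (0 : ℝ)..(2 * Real.pi), f x * Real.cos (n * x)

lemma integral_cos_int_mul (k : ℤ) :
    ∫ x in (0 : ℝ)..(2 * Real.pi), Real.cos (k * x) = if k = 0 then 2 * Real.pi else 0 := by
  split_ifs with h
  · simp [h]
  · have hk : (k : ℝ) ≠ 0 := by exact_mod_cast h
    rw [intervalIntegral.integral_comp_mul_left (fun x => Real.cos x) hk, integral_cos]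
    have : Real.sin (k * (2 * Real.pi)) = 0 := by
      have := Real.sin_int_mul_pi (k * 2)
      push_cast at this
      rw [← this]; ring_nf
    simp [this]

lemma integral_cos_mul_cos (m n : ℕ) :
    ∫ x in (0 : ℝ)..(2 * Real.pi), Real.cos (m * x) * Real.cos (n * x) =
      if m = n then (if n = 0 then 2 * Real.pi else Real.pi) else 0 := by
  have h : ∀ x : ℝ, Real.cos (m * x) * Real.cos (n * x) =
      (1 / 2) * (Real.cos (((m : ℤ) - n : ℤ) * x) + Real.cos (((m : ℤ) + n : ℤ) * x)) := by
    intro x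
    push_cast
    rw [sub_mul, add_mul, Real.cos_sub, Real.cos_add]
    ring
  simp_rw [h]
  rw [intervalIntegral.integral_const_mul, intervalIntegral.integral_add
    (by apply Continuous.intervalIntegrable; fun_prop)
    (by apply Continuous.intervalIntegrable; fun_prop), integral_cos_int_mul, integral_cos_int_mul]
  by_cases hmn : m = n
  · subst hmn
    by_cases h0 : m = 0
    · simp [h0]; ring
    · have : ¬ ((m : ℤ) + m = 0) := by omega
      simp [h0]
  · have h1 : ¬ ((m : ℤ) - n = 0) := by omega
    have h2 : ¬ ((m : ℤ) + n = 0) := by omega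
    simp [hmn, h1, h2]

/-- Dominated convergence with majorant |cₙ||φ|. Absolute summability of the coefficients is all
that termwise testing of a cosine series needs. -/
lemma hasSum_integral_series {c : ℕ → ℝ} (hc : Summable fun n => |c n|) {g : ℕ → ℝ → ℝ}
    (hg : ∀ n, Continuous (g n)) (hg1 : ∀ n x, |g n x| ≤ 1) {φ : ℝ → ℝ} (hφ : Continuous φ)
    (a b : ℝ) :
    HasSum (fun n => c n * ∫ x in a..b, g n x * φ x)
      (∫ x in a..b, (∑' n, c n * g n x) * φ x) := by
  have key := intervalIntegral.hasSum_integral_of_dominated_convergence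
    (μ := volume) (a := a) (b := b)
    (F := fun n x => c n * g n x * φ x) (f := fun x => (∑' n, c n * g n x) * φ x)
    (fun n x => |c n| * |φ x|) (fun n => by
      apply Continuous.aestronglyMeasurable
      have := hg n
      fun_prop) (fun n => by
      refine Filter.Eventually.of_forall fun x _ => ?_
      rw [Real.norm_eq_abs, abs_mul, abs_mul]
      have := mul_le_mul_of_nonneg_left (hg1 n x) (abs_nonneg (c n))
      exact mul_le_mul_of_nonneg_right (by linarith) (abs_nonneg _))
    (Filter.Eventually.of_forall fun x _ => hc.mul_right _)
    (by
      simp_rw [tsum_mul_right]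
      apply Continuous.intervalIntegrable
      fun_prop)
    (Filter.Eventually.of_forall fun x _ => by
      apply HasSum.mul_right
      apply Summable.hasSum
      apply Summable.of_norm_bounded hc
      intro n
      rw [Real.norm_eq_abs, abs_mul]
      simpa using mul_le_mul_of_nonneg_left (hg1 n x) (abs_nonneg (c n)))
  simpa only [mul_assoc, intervalIntegral.integral_const_mul] using key

/-! ### An algebra of cosine series -/

/-- Cosine series `∑ aₙ (1 + n)⁻² cos(nξ)` with `∑ |aₙ| < ∞`. -/
abbrev CosSeq : Type := lp (fun _ : ℕ => ℝ) 1

namespace CosSeq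

lemma summable_abs (a : CosSeq) : Summable fun n => |a n| := by
  simpa using (lp.memℓp a).summable (by simp)

lemma norm_eq (a : CosSeq) : ‖a‖ = ∑' n, |a n| := by
  rw [lp.norm_eq_tsum_rpow (by simp)]; simp

lemma abs_apply_le (a : CosSeq) (n : ℕ) : |a n| ≤ ‖a‖ := by
  rw [norm_eq]
  exact a.summable_abs.le_tsum n (fun _ _ => abs_nonneg _)

/-- Build an element from an absolutely summable sequence. -/
def mk' (f : ℕ → ℝ) (hf : Summable fun n => |f n|) : CosSeq :=
  ⟨f, memℓp_gen (by simpa using hf)⟩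

@[simp] lemma mk'_apply (f : ℕ → ℝ) (hf : Summable fun n => |f n|) (n : ℕ) : mk' f hf n = f n := rfl

/-- The coefficient of `cos(nξ)`. -/
def coef (n : ℕ) (a : CosSeq) : ℝ := a n / (1 + n) ^ 2

lemma one_le_weight (n : ℕ) : (1 : ℝ) ≤ (1 + n) ^ 2 := by
  have : (0 : ℝ) ≤ n := n.cast_nonneg
  nlinarith

lemma weight_pos (n : ℕ) : (0 : ℝ) < (1 + n) ^ 2 := lt_of_lt_of_le one_pos (one_le_weight n)

@[simp] lemma coef_add (n : ℕ) (a b : CosSeq) : coef n (a + b) = coef n a + coef n b := by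
  simp [coef, add_div]

@[simp] lemma coef_sub (n : ℕ) (a b : CosSeq) : coef n (a - b) = coef n a - coef n b := by
  simp [coef, sub_div]

@[simp] lemma coef_neg (n : ℕ) (a : CosSeq) : coef n (-a) = -coef n a := by
  simp [coef, neg_div]

@[simp] lemma coef_smul (n : ℕ) (t : ℝ) (a : CosSeq) : coef n (t • a) = t * coef n a := by
  simp [coef, mul_div_assoc]

lemma abs_coef_le_abs (n : ℕ) (a : CosSeq) : |coef n a| ≤ |a n| := by
  rw [coef, abs_div, abs_of_pos (weight_pos n)]
  exact div_le_self (abs_nonneg _) (one_le_weight n)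

lemma abs_coef_le (n : ℕ) (a : CosSeq) : |coef n a| ≤ ‖a‖ :=
  (abs_coef_le_abs n a).trans (a.abs_apply_le n)

lemma summable_coef (a : CosSeq) : Summable fun n => |coef n a| :=
  Summable.of_nonneg_of_le (fun _ => abs_nonneg _) (fun n => abs_coef_le_abs n a) a.summable_abs

lemma ext_coef {a b : CosSeq} (h : ∀ n, coef n a = coef n b) : a = b := by
  ext n
  have := h n
  rwa [coef, coef, div_left_inj' (weight_pos n).ne'] at this

/-- The function represented by a coefficient sequence. -/
def toFun (a : CosSeq) (ξ : ℝ) : ℝ := ∑' n : ℕ, coef n a * Real.cos (n * ξ)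

lemma summable_toFun (a : CosSeq) (ξ : ℝ) : Summable fun n : ℕ => coef n a * Real.cos (n * ξ) := by
  refine Summable.of_norm_bounded a.summable_coef fun n => ?_
  rw [Real.norm_eq_abs, abs_mul]
  exact mul_le_of_le_one_right (abs_nonneg _) (Real.abs_cos_le_one _)

lemma abs_toFun_le (a : CosSeq) (ξ : ℝ) : |toFun a ξ| ≤ ‖a‖ := by
  rw [norm_eq, ← Real.norm_eq_abs]
  refine tsum_of_norm_bounded a.summable_abs.hasSum fun n => ?_
  rw [Real.norm_eq_abs, abs_mul]
  exact (mul_le_of_le_one_right (abs_nonneg _) (Real.abs_cos_le_one _)).trans (abs_coef_le_abs n a)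

@[simp] lemma toFun_add (a b : CosSeq) (ξ : ℝ) : toFun (a + b) ξ = toFun a ξ + toFun b ξ := by
  simp only [toFun, coef_add, add_mul]
  exact (a.summable_toFun ξ).tsum_add (b.summable_toFun ξ)

@[simp] lemma toFun_smul (t : ℝ) (a : CosSeq) (ξ : ℝ) : toFun (t • a) ξ = t * toFun a ξ := by
  simp only [toFun, coef_smul, mul_assoc, tsum_mul_left]

@[simp] lemma toFun_neg (a : CosSeq) (ξ : ℝ) : toFun (-a) ξ = - toFun a ξ := by
  rw [← neg_one_smul ℝ, toFun_smul]; ring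

@[simp] lemma toFun_sub (a b : CosSeq) (ξ : ℝ) : toFun (a - b) ξ = toFun a ξ - toFun b ξ := by
  rw [sub_eq_add_neg, toFun_add, toFun_neg]; ring

@[simp] lemma toFun_zero (ξ : ℝ) : toFun 0 ξ = 0 := by
  simpa using toFun_smul 0 0 ξ

lemma continuous_toFun (a : CosSeq) : Continuous (toFun a) := by
  refine continuous_tsum (u := fun n => |coef n a|) (fun n => by fun_prop) a.summable_coef ?_
  intro n x
  rw [Real.norm_eq_abs, abs_mul]
  exact mul_le_of_le_one_right (abs_nonneg _) (Real.abs_cos_le_one _)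

lemma toFun_even (a : CosSeq) (ξ : ℝ) : toFun a (-ξ) = toFun a ξ := by
  simp [toFun]

lemma toFun_periodic (a : CosSeq) : Function.Periodic (toFun a) (2 * Real.pi) := by
  intro ξ
  simp only [toFun, mul_add]
  congr! 3 with n
  exact Real.cos_add_nat_mul_two_pi _ n

lemma integral_toFun_mul_cos (a : CosSeq) (n : ℕ) :
    ∫ x in (0 : ℝ)..(2 * Real.pi), toFun a x * Real.cos (n * x) =
      (if n = 0 then 2 * Real.pi else Real.pi) * coef n a := by
  have h := hasSum_integral_series a.summable_coef (g := fun n x => Real.cos (n * x))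
    (fun n => by fun_prop) (fun n x => Real.abs_cos_le_one _) (φ := fun x => Real.cos (n * x))
    (by fun_prop) 0 (2 * Real.pi)
  simp_rw [integral_cos_mul_cos] at h
  refine h.unique ?_
  convert hasSum_ite_eq n ((if n = 0 then 2 * Real.pi else Real.pi) * coef n a) using 2 with m
  by_cases hm : m = n
  · subst hm; simp [mul_comm]
  · simp [hm]

lemma cosCoeff_toFun (a : CosSeq) {n : ℕ} (hn : n ≠ 0) : cosCoeff n (toFun a) = coef n a := by
  rw [cosCoeff, integral_toFun_mul_cos, if_neg hn]
  field_simp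

lemma integral_toFun (a : CosSeq) :
    ∫ x in (0 : ℝ)..(2 * Real.pi), toFun a x = 2 * Real.pi * coef 0 a := by
  simpa using integral_toFun_mul_cos a 0

lemma toFun_injective : Function.Injective toFun := by
  intro a b h
  refine ext_coef fun n => ?_
  have h1 := integral_toFun_mul_cos a n
  rw [h, integral_toFun_mul_cos] at h1
  refine (mul_left_cancel₀ ?_ h1).symm
  split_ifs <;> positivity

lemma ext_toFun {a b : CosSeq} (h : ∀ ξ, toFun a ξ = toFun b ξ) : a = b :=
  toFun_injective (funext h)

/-- The element representing `cos(nξ)`. -/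
def e (n : ℕ) : CosSeq := lp.single 1 n ((1 + n : ℝ) ^ 2)

lemma norm_e (n : ℕ) : ‖e n‖ = (1 + n) ^ 2 := by
  rw [e, lp.norm_single (by simp), Real.norm_eq_abs, abs_of_pos (weight_pos n)]

lemma coef_e (m n : ℕ) : coef m (e n) = if m = n then 1 else 0 := by
  rw [coef, e, lp.single_apply]
  split_ifs with h
  · subst h; simpa using div_self (weight_pos m).ne'
  · simp [h]

@[simp] lemma toFun_e (n : ℕ) (ξ : ℝ) : toFun (e n) ξ = Real.cos (n * ξ) := by
  rw [toFun, tsum_eq_single n]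
  · simp [coef_e]
  · intro m hm
    simp [coef_e, hm]

/-- Evaluation at a point as a continuous linear functional. -/
def eval (ξ : ℝ) : CosSeq →L[ℝ] ℝ :=
  LinearMap.mkContinuous
    { toFun := fun a => toFun a ξ
      map_add' := fun a b => toFun_add a b ξ
      map_smul' := fun t a => toFun_smul t a ξ } 1
    (fun a => by simpa using abs_toFun_le a ξ)

lemma eval_apply (ξ : ℝ) (a : CosSeq) : eval ξ a = toFun a ξ := rfl

/-! ### Products and diagonal operators -/

/-- The product of the basis functions with indices `p.1` and `p.2`. -/
def basisMul (p : ℕ × ℕ) : CosSeq :=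
  (1 / 2 : ℝ) • (e (p.1 + p.2) + e (Nat.dist p.1 p.2))

lemma toFun_basisMul (p : ℕ × ℕ) (ξ : ℝ) :
    toFun (basisMul p) ξ = Real.cos (p.1 * ξ) * Real.cos (p.2 * ξ) := by
  have h : Real.cos ((Nat.dist p.1 p.2 : ℕ) * ξ) = Real.cos ((p.1 - p.2 : ℝ) * ξ) := by
    rcases le_total p.1 p.2 with h | h
    · rw [Nat.dist_eq_sub_of_le h, Nat.cast_sub h, ← Real.cos_neg]; ring_nf
    · rw [Nat.dist_eq_sub_of_le_right h, Nat.cast_sub h]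
  simp only [basisMul, toFun_smul, toFun_add, toFun_e, h]
  push_cast
  rw [sub_mul, add_mul, Real.cos_sub, Real.cos_add]
  ring

/-- 1 + p + q ≤ (1 + p)(1 + q) and |p - q| ≤ p + q: the weight is submultiplicative, which turns the
coefficient space into a Banach algebra. -/
lemma norm_basisMul_le (p : ℕ × ℕ) : ‖basisMul p‖ ≤ (1 + p.1 : ℝ) ^ 2 * (1 + p.2) ^ 2 := by
  have h1 : ‖e (p.1 + p.2)‖ ≤ (1 + p.1 : ℝ) ^ 2 * (1 + p.2) ^ 2 := by
    rw [norm_e, ← mul_pow]; push_cast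
    have : (0 : ℝ) ≤ (p.1 : ℝ) * p.2 := by positivity
    gcongr; linarith
  have h2 : ‖e (Nat.dist p.1 p.2)‖ ≤ (1 + p.1 : ℝ) ^ 2 * (1 + p.2) ^ 2 := by
    refine le_trans ?_ h1
    rw [norm_e, norm_e]
    have : Nat.dist p.1 p.2 ≤ p.1 + p.2 := by unfold Nat.dist; omega
    gcongr
  rw [basisMul, norm_smul]
  have := norm_add_le (e (p.1 + p.2)) (e (Nat.dist p.1 p.2))
  rw [Real.norm_of_nonneg (by norm_num)]
  linarith

lemma norm_mulTerm_le (a b : CosSeq) (p : ℕ × ℕ) :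
    ‖(coef p.1 a * coef p.2 b) • basisMul p‖ ≤ |a p.1| * |b p.2| := by
  rw [norm_smul, Real.norm_eq_abs, abs_mul]
  refine (mul_le_mul_of_nonneg_left (norm_basisMul_le p) (by positivity)).trans (le_of_eq ?_)
  rw [coef, coef, abs_div, abs_div, abs_of_pos (weight_pos _), abs_of_pos (weight_pos _)]
  have := weight_pos p.1
  have := weight_pos p.2
  field_simp

lemma summable_abs_mul (a b : CosSeq) : Summable fun p : ℕ × ℕ => |a p.1| * |b p.2| :=
  a.summable_abs.mul_of_nonneg b.summable_abs (fun _ => abs_nonneg _) (fun _ => abs_nonneg _)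

lemma summable_mulTerm (a b : CosSeq) :
    Summable fun p : ℕ × ℕ => (coef p.1 a * coef p.2 b) • basisMul p :=
  Summable.of_norm_bounded (summable_abs_mul a b) (norm_mulTerm_le a b)

/-- The product, which represents pointwise multiplication of functions. -/
def mul (a b : CosSeq) : CosSeq := ∑' p : ℕ × ℕ, (coef p.1 a * coef p.2 b) • basisMul p

local infixl:70 " ⋆ " => mul

lemma norm_mul_le (a b : CosSeq) : ‖a ⋆ b‖ ≤ ‖a‖ * ‖b‖ := by
  refine (tsum_of_norm_bounded (summable_abs_mul a b).hasSum (norm_mulTerm_le a b)).trans_eq ?_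
  have h := a.summable_abs.tsum_mul_tsum b.summable_abs (summable_abs_mul a b)
  rw [← norm_eq, ← norm_eq] at h
  exact h.symm

-- Together with `ext_toFun` this lets identities between products be checked pointwise by `ring`,
-- so no ring axioms for `mul` are needed.
@[simp] lemma toFun_mul (a b : CosSeq) (ξ : ℝ) : toFun (a ⋆ b) ξ = toFun a ξ * toFun b ξ := by
  rw [← eval_apply, mul, (eval ξ).map_tsum (summable_mulTerm a b), toFun, toFun]
  have hs : ∀ a : CosSeq, Summable fun n : ℕ => ‖coef n a * Real.cos (n * ξ)‖ :=
    fun a => (a.summable_toFun ξ).norm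
  rw [tsum_mul_tsum_of_summable_norm (hs a) (hs b)]
  refine tsum_congr fun p => ?_
  rw [map_smul, eval_apply, toFun_basisMul, smul_eq_mul]
  ring

/-- The diagonal operator with bounded multipliers `d`. -/
def diag (d : ℕ → ℝ) (K : ℝ) (hd : ∀ n, |d n| ≤ K) (a : CosSeq) : CosSeq :=
  mk' (fun n => d n * a n) (by
    refine Summable.of_nonneg_of_le (fun _ => abs_nonneg _) (fun n => ?_)
      (a.summable_abs.mul_left K)
    rw [abs_mul]
    exact mul_le_mul_of_nonneg_right (hd n) (abs_nonneg _))

lemma coef_diag (d : ℕ → ℝ) (K : ℝ) (hd : ∀ n, |d n| ≤ K) (a : CosSeq) (n : ℕ) :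
    coef n (diag d K hd a) = d n * coef n a := by
  rw [coef, coef, diag, mk'_apply, mul_div_assoc]

lemma norm_le_of_coef {a b : CosSeq} {K : ℝ} (h : ∀ n, |coef n a| ≤ K * |coef n b|) :
    ‖a‖ ≤ K * ‖b‖ := by
  rw [norm_eq, norm_eq, ← tsum_mul_left]
  refine a.summable_abs.tsum_le_tsum (fun n => ?_) (b.summable_abs.mul_left K)
  have := h n
  rwa [coef, coef, abs_div, abs_div, abs_of_pos (weight_pos n), ← mul_div_assoc,
    div_le_div_iff_of_pos_right (weight_pos n)] at this

end CosSeq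

/-! ### Trigonometric test functions -/

/-- The `j`-th derivative of `cos(nx + θ)`. -/
def trig (n θ : ℝ) (j : ℕ) (x : ℝ) : ℝ := n ^ j * Real.cos (n * x + θ + j * (Real.pi / 2))

lemma trig_zero (n θ : ℝ) : trig n θ 0 = fun x => Real.cos (n * x + θ) := by
  ext x; simp [trig]

lemma trig_two (n θ x : ℝ) : trig n θ 2 x = -(n ^ 2 * Real.cos (n * x + θ)) := by
  have h : n * x + θ + (2 : ℕ) * (Real.pi / 2) = n * x + θ + Real.pi := by push_cast; ring
  rw [trig, h, Real.cos_add_pi]; ring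

lemma trig_six (n θ x : ℝ) : trig n θ 6 x = -(n ^ 6 * Real.cos (n * x + θ)) := by
  have h : n * x + θ + (6 : ℕ) * (Real.pi / 2) = n * x + θ + 2 * Real.pi + Real.pi := by
    push_cast; ring
  rw [trig, h, Real.cos_add_pi, Real.cos_add_two_pi]; ring

lemma contDiff_trig (n θ : ℝ) (j : ℕ) : ContDiff ℝ (⊤ : ℕ∞) (trig n θ j) := by
  unfold trig; fun_prop

lemma continuous_trig (n θ : ℝ) (j : ℕ) : Continuous (trig n θ j) := (contDiff_trig n θ j).continuous

lemma hasDerivAt_trig (n θ : ℝ) (j : ℕ) (x : ℝ) :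
    HasDerivAt (trig n θ j) (trig n θ (j + 1) x) x := by
  have h : HasDerivAt (fun x : ℝ => n * x + θ + j * (Real.pi / 2)) (n * 1) x :=
    (((hasDerivAt_id x).const_mul n).add_const θ).add_const _
  have h2 : n * x + θ + (j + 1 : ℕ) * (Real.pi / 2) =
    n * x + θ + j * (Real.pi / 2) + Real.pi / 2 := by push_cast; ring
  refine HasDerivAt.congr_deriv (h.cos.const_mul (n ^ j)) ?_
  rw [trig, h2, Real.cos_add_pi_div_two]; ring

lemma iteratedDeriv_trig (n θ : ℝ) (j : ℕ) : iteratedDeriv j (trig n θ 0) = trig n θ j := by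
  induction j with
  | zero => simp
  | succ j ih =>
    rw [iteratedDeriv_succ, ih]
    ext x
    exact (hasDerivAt_trig n θ j x).deriv

lemma periodic_trig (n : ℕ) (θ : ℝ) (j : ℕ) : Function.Periodic (trig n θ j) (2 * Real.pi) := by
  intro x
  have h : n * (x + 2 * Real.pi) + θ + j * (Real.pi / 2) =
    n * x + θ + j * (Real.pi / 2) + n * (2 * Real.pi) := by ring
  rw [trig, trig, h, Real.cos_add_nat_mul_two_pi]

lemma abs_trig_le (n θ : ℝ) (j : ℕ) (x : ℝ) : |trig n θ j x| ≤ |n| ^ j := by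
  rw [trig, abs_mul, abs_pow]
  exact mul_le_of_le_one_right (by positivity) (Real.abs_cos_le_one _)

lemma integral_mul_deriv_periodic {f g f' g' : ℝ → ℝ} (hf : ∀ x, HasDerivAt f (f' x) x)
    (hg : ∀ x, HasDerivAt g (g' x) x) (hf' : Continuous f') (hg' : Continuous g')
    (pf : Function.Periodic f (2 * Real.pi)) (pg : Function.Periodic g (2 * Real.pi)) :
    ∫ x in (0 : ℝ)..(2 * Real.pi), f x * g' x = -∫ x in (0 : ℝ)..(2 * Real.pi), f' x * g x := by
  rw [intervalIntegral.integral_mul_deriv_eq_deriv_mul (fun x _ => hf x) (fun x _ => hg x)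
    (hf'.intervalIntegrable _ _) (hg'.intervalIntegrable _ _)]
  have h1 : f (2 * Real.pi) = f 0 := by simpa using pf 0
  have h2 : g (2 * Real.pi) = g 0 := by simpa using pg 0
  rw [h1, h2]; ring

lemma periodic_iteratedDeriv {φ : ℝ → ℝ} {T : ℝ} (h : Function.Periodic φ T) (j : ℕ) :
    Function.Periodic (iteratedDeriv j φ) T := by
  intro x
  have := congrFun (iteratedDeriv_comp_add_const j φ T) x
  rw [← this]
  congr 1
  exact funext h

lemma contDiff_iteratedDeriv {φ : ℝ → ℝ} (h : ContDiff ℝ (⊤ : ℕ∞) φ) (j : ℕ) :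
    ContDiff ℝ (⊤ : ℕ∞) (iteratedDeriv j φ) := by
  rw [iteratedDeriv_eq_iterate]
  exact h.iterate_deriv j

lemma hasDerivAt_iteratedDeriv {φ : ℝ → ℝ} (h : ContDiff ℝ (⊤ : ℕ∞) φ) (j : ℕ) (x : ℝ) :
    HasDerivAt (iteratedDeriv j φ) (iteratedDeriv (j + 1) φ x) x := by
  rw [iteratedDeriv_succ]
  exact ((contDiff_iteratedDeriv h j).differentiable (by simp) x).hasDerivAt

lemma integral_trig_mul_iteratedDeriv (n : ℕ) (θ : ℝ) {φ : ℝ → ℝ} (hφ : ContDiff ℝ (⊤ : ℕ∞) φ)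
    (pφ : Function.Periodic φ (2 * Real.pi)) (j i : ℕ) :
    ∫ x in (0 : ℝ)..(2 * Real.pi), trig n θ i x * iteratedDeriv j φ x =
      (-1) ^ j * ∫ x in (0 : ℝ)..(2 * Real.pi), trig n θ (i + j) x * φ x := by
  induction j generalizing i with
  | zero => simp
  | succ j ih =>
    rw [integral_mul_deriv_periodic (hasDerivAt_trig n θ i) (hasDerivAt_iteratedDeriv hφ j)
      (continuous_trig _ _ _) (contDiff_iteratedDeriv hφ (j + 1)).continuous (periodic_trig _ _ _)
      (periodic_iteratedDeriv pφ j), ih, pow_succ, show i + 1 + j = i + (j + 1) by ring]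
    ring

/-! ### Completeness of the trigonometric system -/

lemma intervalIntegrable_of_memLp {f : ℝ → ℝ}
    (hf : MemLp f 2 (volume.restrict (Set.Ioc 0 (2 * Real.pi)))) :
    IntervalIntegrable f volume 0 (2 * Real.pi) := by
  rw [intervalIntegrable_iff_integrableOn_Ioc_of_le (by positivity)]
  exact hf.integrable (by norm_num)

/-- Parseval. The phase θ treats cosines and sines together: θ = 0 and θ = π/2 give the real and
imaginary parts of the complex Fourier coefficients, up to normalisation. -/
lemma ae_eq_zero_of_integral_trig {f : ℝ → ℝ}
    (hf : MemLp f 2 (volume.restrict (Set.Ioc 0 (2 * Real.pi))))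
    (h : ∀ (n : ℕ) (θ : ℝ), ∫ x in (0 : ℝ)..(2 * Real.pi), f x * Real.cos (n * x + θ) = 0) :
    f =ᵐ[volume.restrict (Set.Ioc 0 (2 * Real.pi))] 0 := by
  have hpi : (0 : ℝ) < 2 * Real.pi := by positivity
  have hint := intervalIntegrable_of_memLp hf
  have hz : ∀ (n : ℤ) (θ : ℝ), ∫ x in (0 : ℝ)..(2 * Real.pi), f x * Real.cos (n * x + θ) = 0 := by
    intro n θ
    obtain ⟨m, rfl | rfl⟩ := n.eq_nat_or_neg
    · simpa using h m θ
    · have hx : ∀ x : ℝ, Real.cos (((-(m : ℤ) : ℤ) : ℝ) * x + θ) = Real.cos (m * x + -θ) := by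
        intro x
        rw [← Real.cos_neg]; push_cast; ring_nf
      simp_rw [hx, h]
  have hfc : MemLp (fun x => (f x : ℂ)) 2 (volume.restrict (Set.Ioc 0 (2 * Real.pi))) := hf.ofReal
  have hs := hasSum_sq_fourierCoeffOn hpi hfc
  have hc : ∀ n : ℤ, fourierCoeffOn hpi (fun x => (f x : ℂ)) n = 0 := by
    intro n
    rw [fourierCoeffOn_eq_integral]
    have hfun : ∀ x : ℝ, fourier (-n) (x : AddCircle (2 * Real.pi - 0)) • (f x : ℂ) =
        ((f x * Real.cos (n * x + 0) : ℝ) : ℂ) +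
          Complex.I * ((f x * Real.cos (n * x + Real.pi / 2) : ℝ) : ℂ) := by
      intro x
      rw [fourier_coe_apply, Real.cos_add_pi_div_two, smul_eq_mul]
      have : 2 * (Real.pi : ℂ) * Complex.I * ((-n : ℤ) : ℂ) * x / ((2 * Real.pi - 0 : ℝ) : ℂ) =
          ((-(n * x) : ℝ) : ℂ) * Complex.I := by
        push_cast
        have : (Real.pi : ℂ) ≠ 0 := by exact_mod_cast Real.pi_ne_zero
        field_simp
        ring
      rw [this, Complex.exp_mul_I, ← Complex.ofReal_cos, ← Complex.ofReal_sin]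
      simp
      ring
    have hi : ∀ θ : ℝ, IntervalIntegrable (fun x : ℝ => ((f x * Real.cos (n * x + θ) : ℝ) : ℂ))
        volume 0 (2 * Real.pi) := by
      intro θ
      have h1 : IntervalIntegrable (fun x : ℝ => f x * Real.cos (n * x + θ))
        volume 0 (2 * Real.pi) := hint.mul_continuousOn (by fun_prop)
      rw [intervalIntegrable_iff_integrableOn_Ioc_of_le hpi.le] at h1 ⊢
      exact h1.ofReal
    simp_rw [hfun]
    rw [intervalIntegral.integral_add, intervalIntegral.integral_const_mul,
      intervalIntegral.integral_ofReal, intervalIntegral.integral_ofReal, hz, hz]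
    · simp
    · exact hi 0
    · exact (hi (Real.pi / 2)).const_mul _
  simp only [hc, norm_zero, ne_eq, OfNat.ofNat_ne_zero, not_false_eq_true, zero_pow] at hs
  have h0 := hs.unique hasSum_zero
  rw [smul_eq_zero, intervalIntegral.integral_of_le hpi.le] at h0
  have h1 := h0.resolve_left (inv_ne_zero (by linarith))
  rw [integral_eq_zero_iff_of_nonneg (fun x => by positivity)
    (by simpa using hf.integrable_sq)] at h1
  filter_upwards [h1] with x hx
  simpa using hx

lemma ae_eq_of_integral_trig {f g : ℝ → ℝ}
    (hf : MemLp f 2 (volume.restrict (Set.Ioc 0 (2 * Real.pi))))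
    (hg : MemLp g 2 (volume.restrict (Set.Ioc 0 (2 * Real.pi))))
    (h : ∀ (n : ℕ) (θ : ℝ), ∫ x in (0 : ℝ)..(2 * Real.pi), f x * Real.cos (n * x + θ) =
      ∫ x in (0 : ℝ)..(2 * Real.pi), g x * Real.cos (n * x + θ)) :
    f =ᵐ[volume.restrict (Set.Ioc 0 (2 * Real.pi))] g := by
  have := ae_eq_zero_of_integral_trig (hf.sub hg) (fun n θ => by
    simp only [Pi.sub_apply, sub_mul]
    rw [intervalIntegral.integral_sub ((intervalIntegrable_of_memLp hf).mul_continuousOn (by fun_prop))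
      ((intervalIntegrable_of_memLp hg).mul_continuousOn (by fun_prop)), h, sub_self])
  filter_upwards [this] with x hx
  simpa [sub_eq_zero] using hx

/-! ### Weak derivatives -/

lemma memLp_of_continuous {f : ℝ → ℝ} (hf : Continuous f) :
    MemLp f 2 (volume.restrict (Set.Ioc 0 (2 * Real.pi))) := by
  obtain ⟨C, hC⟩ := isCompact_Icc.exists_bound_of_continuousOn (hf.continuousOn (s := Set.Icc 0 (2 * Real.pi)))
  refine MemLp.of_bound hf.aestronglyMeasurable C ?_
  exact (ae_restrict_iff' measurableSet_Ioc).2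
    (Filter.Eventually.of_forall fun x hx => hC x (Set.Ioc_subset_Icc_self hx))

lemma HasWeakDeriv.integral_trig {j : ℕ} {u v : ℝ → ℝ} (h : HasWeakDeriv j u v) (n : ℕ) (θ : ℝ) :
    ∫ x in (0 : ℝ)..(2 * Real.pi), u x * trig n θ j x =
      (-1) ^ j * ∫ x in (0 : ℝ)..(2 * Real.pi), v x * Real.cos (n * x + θ) := by
  have := h (trig n θ 0) (contDiff_trig n θ 0) (periodic_trig n θ 0)
  rwa [iteratedDeriv_trig, trig_zero] at this

lemma weakDeriv_spec {j : ℕ} {u : ℝ → ℝ} (h : ∃ v, MemL2per v ∧ HasWeakDeriv j u v) :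
    MemL2per (weakDeriv j u) ∧ HasWeakDeriv j u (weakDeriv j u) := by
  rw [weakDeriv, dif_pos h]
  exact h.choose_spec

/-- The choice made in `weakDeriv` is harmless: integration by parts against trigonometric functions
determines all Fourier coefficients of a weak derivative. -/
lemma weakDeriv_ae_eq {j : ℕ} {u v : ℝ → ℝ} (hv : MemL2per v) (h : HasWeakDeriv j u v) :
    weakDeriv j u =ᵐ[volume.restrict (Set.Ioc 0 (2 * Real.pi))] v := by
  obtain ⟨h1, h2⟩ := weakDeriv_spec ⟨v, hv, h⟩
  refine ae_eq_of_integral_trig h1.2 hv.2 fun n θ => ?_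
  have := (h2.integral_trig n θ).symm.trans (h.integral_trig n θ)
  exact mul_left_cancel₀ (by simp) this

lemma memL2per_onePlus {k : ℝ} {u : ℝ → ℝ} (hu : MemL2per u)
    (h : ∃ v, MemL2per v ∧ HasWeakDeriv 2 u v) : MemL2per (onePlus k u) := by
  obtain ⟨h1, -⟩ := weakDeriv_spec h
  refine ⟨fun x => ?_, hu.2.add (h1.2.const_mul (k ^ 2))⟩
  simp only [onePlus, hu.1 x, h1.1 x]

lemma integral_onePlus {k : ℝ} {u : ℝ → ℝ} (hu : MemL2per u)
    (h : ∃ v, MemL2per v ∧ HasWeakDeriv 2 u v) (n : ℕ) (θ : ℝ) :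
    ∫ x in (0 : ℝ)..(2 * Real.pi), onePlus k u x * Real.cos (n * x + θ) =
      (1 - k ^ 2 * n ^ 2) * ∫ x in (0 : ℝ)..(2 * Real.pi), u x * Real.cos (n * x + θ) := by
  obtain ⟨h1, h2⟩ := weakDeriv_spec h
  have h3 := h2.integral_trig n θ
  have h4 : ∀ x, u x * trig n θ 2 x = -(n : ℝ) ^ 2 * (u x * Real.cos (n * x + θ)) := by
    intro x; rw [trig_two]; ring
  simp_rw [h4] at h3
  rw [intervalIntegral.integral_const_mul] at h3
  have h5 : ∀ x, onePlus k u x * Real.cos (n * x + θ) =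
      u x * Real.cos (n * x + θ) + k ^ 2 * (weakDeriv 2 u x * Real.cos (n * x + θ)) := by
    intro x; simp only [onePlus]; ring
  simp_rw [h5]
  rw [intervalIntegral.integral_add, intervalIntegral.integral_const_mul]
  · linear_combination (-k ^ 2) * h3
  · exact (intervalIntegrable_of_memLp hu.2).mul_continuousOn (by fun_prop)
  · exact ((intervalIntegrable_of_memLp h1.2).mul_continuousOn (by fun_prop)).const_mul _

lemma MemH6per.memL2per {u : ℝ → ℝ} (hu : MemH6per u) : MemL2per u :=
  ⟨hu.periodic, memLp_of_continuous hu.continuous⟩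

/-- Without this, the outer `onePlus` could involve the default value 0 of `weakDeriv`. The
derivative is u'' + k²u'''', found by testing the second derivative of `u` with φ'' and comparing
with the fourth. -/
lemma MemH6per.exists_weakDeriv_onePlus {u : ℝ → ℝ} (hu : MemH6per u) (k : ℝ) :
    ∃ v, MemL2per v ∧ HasWeakDeriv 2 (onePlus k u) v := by
  obtain ⟨h1, h2⟩ := weakDeriv_spec (hu.weakDeriv 2 (by norm_num))
  obtain ⟨h3, h4⟩ := weakDeriv_spec (hu.weakDeriv 4 (by norm_num))
  refine ⟨fun x => PatternCL.weakDeriv 2 u x + k ^ 2 * PatternCL.weakDeriv 4 u x,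
    ⟨fun x => by simp only [h1.1 x, h3.1 x], h1.2.add (h3.2.const_mul (k ^ 2))⟩, ?_⟩
  intro φ hφ pφ
  have hc := (contDiff_iteratedDeriv hφ 2)
  have e1 := h2 φ hφ pφ
  have e2 := h4 φ hφ pφ
  have e3 := h2 _ hc (periodic_iteratedDeriv pφ 2)
  have e4 : iteratedDeriv 2 (iteratedDeriv 2 φ) = iteratedDeriv 4 φ := by
    simp only [iteratedDeriv_eq_iterate, ← Function.iterate_add_apply]
  rw [e4] at e3
  have hcc := hc.continuous
  have hφc := hφ.continuous
  have iu := intervalIntegrable_of_memLp hu.memL2per.2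
  have i2 := intervalIntegrable_of_memLp h1.2
  have i4 := intervalIntegrable_of_memLp h3.2
  simp only [onePlus, add_mul, mul_assoc]
  rw [intervalIntegral.integral_add (iu.mul_continuousOn hcc.continuousOn)
      ((i2.mul_continuousOn hcc.continuousOn).const_mul _),
    intervalIntegral.integral_add (i2.mul_continuousOn hφc.continuousOn)
      ((i4.mul_continuousOn hφc.continuousOn).const_mul _),
    intervalIntegral.integral_const_mul, intervalIntegral.integral_const_mul]
  linear_combination e1 - k ^ 2 * e3 + k ^ 2 * e2

lemma MemH6per.memL2per_onePlus_onePlus {u : ℝ → ℝ} (hu : MemH6per u) (k : ℝ) :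
    MemL2per (onePlus k (onePlus k u)) :=
  memL2per_onePlus (memL2per_onePlus hu.memL2per (hu.weakDeriv 2 (by norm_num)))
    (hu.exists_weakDeriv_onePlus k)

lemma MemH6per.integral_onePlus_onePlus {u : ℝ → ℝ} (hu : MemH6per u) (k : ℝ) (n : ℕ) (θ : ℝ) :
    ∫ x in (0 : ℝ)..(2 * Real.pi), onePlus k (onePlus k u) x * Real.cos (n * x + θ) =
      (1 - k ^ 2 * n ^ 2) ^ 2 * ∫ x in (0 : ℝ)..(2 * Real.pi), u x * Real.cos (n * x + θ) := by
  rw [integral_onePlus (memL2per_onePlus hu.memL2per (hu.weakDeriv 2 (by norm_num)))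
    (hu.exists_weakDeriv_onePlus k), integral_onePlus hu.memL2per (hu.weakDeriv 2 (by norm_num))]
  ring

/-! ### The profile equation in terms of cosine coefficients -/

/-- The reflection x ↦ 2π - x kills the sine integral, so every phase reduces to the cosine
coefficient. -/
lemma integral_even_mul_cos {f : ℝ → ℝ} (hf : Continuous f) (he : ∀ x, f (-x) = f x)
    (hp : Function.Periodic f (2 * Real.pi)) (n : ℕ) (θ : ℝ) :
    ∫ x in (0 : ℝ)..(2 * Real.pi), f x * Real.cos (n * x + θ) =
      Real.cos θ * (Real.pi * cosCoeff n f) := by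
  have hs : ∫ x in (0 : ℝ)..(2 * Real.pi), f x * Real.sin (n * x) = 0 := by
    have h := intervalIntegral.integral_comp_sub_left (a := 0) (b := 2 * Real.pi)
      (fun x => f x * Real.sin (n * x)) (2 * Real.pi)
    have h2 : ∀ x, f (2 * Real.pi - x) * Real.sin (n * (2 * Real.pi - x)) =
        -(f x * Real.sin (n * x)) := by
      intro x
      rw [sub_eq_neg_add, hp, he, mul_add, Real.sin_add_nat_mul_two_pi, mul_neg, Real.sin_neg]
      ring
    simp_rw [h2] at h
    rw [intervalIntegral.integral_neg] at h
    simp only [sub_self, sub_zero] at h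
    linarith
  have h1 : ∀ x, f x * Real.cos (n * x + θ) =
      Real.cos θ * (f x * Real.cos (n * x)) - Real.sin θ * (f x * Real.sin (n * x)) := by
    intro x; rw [Real.cos_add]; ring
  simp_rw [h1]
  rw [intervalIntegral.integral_sub, intervalIntegral.integral_const_mul,
    intervalIntegral.integral_const_mul, hs, cosCoeff]
  · field_simp
    ring
  all_goals apply Continuous.intervalIntegrable; fun_prop

lemma integral_const_mul_cos (m : ℝ) {n : ℕ} (hn : n ≠ 0) (θ : ℝ) :
    ∫ x in (0 : ℝ)..(2 * Real.pi), m * Real.cos (n * x + θ) = 0 := by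
  rw [integral_even_mul_cos (f := fun _ => m) continuous_const (fun _ => rfl) (fun _ => rfl),
    cosCoeff, intervalIntegral.integral_const_mul]
  have := integral_cos_int_mul n
  rw [if_neg (by exact_mod_cast hn)] at this
  push_cast at this
  rw [this]; ring

/-- An even `H⁶` function solves the profile equation for some constant if and only if all its
cosine coefficients of positive index satisfy the corresponding scalar equations. -/
lemma exists_solvesProfile_iff {ε k s : ℝ} (hk : k ≠ 0) {u : ℝ → ℝ} (hu : MemH6per u)
    (he : ∀ ξ, u (-ξ) = u ξ) :
    (∃ q, SolvesProfile ε k s q u) ↔ ∀ n : ℕ, n ≠ 0 →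
      ((1 - k ^ 2 * n ^ 2) ^ 2 - ε ^ 2) * cosCoeff n u +
        cosCoeff n (fun ξ => s * u ξ ^ 2 + u ξ ^ 3) = 0 := by
  set P := onePlus k (onePlus k u) with hP
  set N : ℝ → ℝ := fun ξ => s * u ξ ^ 2 + u ξ ^ 3 with hN
  set F : ℝ → ℝ := fun ξ => P ξ - ε ^ 2 * u ξ + N ξ with hF
  have huc := hu.continuous
  have hNc : Continuous N := by fun_prop
  have hNe : ∀ ξ, N (-ξ) = N ξ := fun ξ => by simp only [hN, he]
  have hNp : Function.Periodic N (2 * Real.pi) := fun ξ => by simp only [hN, hu.periodic ξ]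
  have hPm : MemL2per P := hu.memL2per_onePlus_onePlus k
  have hFm : MemLp F 2 (volume.restrict (Set.Ioc 0 (2 * Real.pi))) :=
    (hPm.2.sub (hu.memL2per.2.const_mul (ε ^ 2))).add (memLp_of_continuous hNc)
  have hFi : ∀ (n : ℕ) (θ : ℝ), ∫ x in (0 : ℝ)..(2 * Real.pi), F x * Real.cos (n * x + θ) =
      Real.cos θ * (Real.pi * (((1 - k ^ 2 * n ^ 2) ^ 2 - ε ^ 2) * cosCoeff n u +
        cosCoeff n N)) := by
    intro n θ
    have h1 : ∀ x, F x * Real.cos (n * x + θ) = P x * Real.cos (n * x + θ) -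
      ε ^ 2 * (u x * Real.cos (n * x + θ)) + N x * Real.cos (n * x + θ) := by
      intro x; simp only [hF]; ring
    simp_rw [h1]
    have iP : IntervalIntegrable (fun x => P x * Real.cos (n * x + θ)) volume 0 (2 * Real.pi) :=
      (intervalIntegrable_of_memLp hPm.2).mul_continuousOn (by fun_prop)
    have iu : IntervalIntegrable (fun x => ε ^ 2 * (u x * Real.cos (n * x + θ))) volume 0
      (2 * Real.pi) := by apply Continuous.intervalIntegrable; fun_prop
    have iN : IntervalIntegrable (fun x => N x * Real.cos (n * x + θ)) volume 0
      (2 * Real.pi) := by apply Continuous.intervalIntegrable; fun_prop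
    rw [intervalIntegral.integral_add (iP.sub iu) iN, intervalIntegral.integral_sub iP iu,
      intervalIntegral.integral_const_mul, hu.integral_onePlus_onePlus,
      integral_even_mul_cos huc he hu.periodic, integral_even_mul_cos hNc hNe hNp]
    ring
  have hsol : ∀ q, SolvesProfile ε k s q u ↔
      F =ᵐ[volume.restrict (Set.Ioc 0 (2 * Real.pi))] fun _ => q / k ^ 2 := by
    intro q
    refine Filter.eventually_congr (Filter.Eventually.of_forall fun ξ => ?_)
    simp only [hF, hN]
    rw [eq_div_iff (pow_ne_zero 2 hk)]
    constructor <;> intro h <;> linear_combination h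
  constructor
  · rintro ⟨q, hq⟩ n hn
    rw [hsol] at hq
    have h1 := hFi n 0
    have h2 : ∫ x in (0 : ℝ)..(2 * Real.pi), F x * Real.cos (n * x + 0) =
        ∫ x in (0 : ℝ)..(2 * Real.pi), q / k ^ 2 * Real.cos (n * x + 0) := by
      apply intervalIntegral.integral_congr_ae_restrict
      rw [Set.uIoc_of_le (by positivity)]
      filter_upwards [hq] with x hx
      rw [hx]
    rw [h2, integral_const_mul_cos _ hn, Real.cos_zero, one_mul] at h1
    exact ((mul_eq_zero.1 h1.symm).resolve_left Real.pi_ne_zero)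
  · intro h
    -- Mode zero imposes no condition: it only fixes the constant, as k² times the mean of `F`.
    set m : ℝ := (2 * Real.pi)⁻¹ * ∫ x in (0 : ℝ)..(2 * Real.pi), F x with hm
    refine ⟨m * k ^ 2, (hsol _).2 ?_⟩
    rw [mul_div_cancel_right₀ _ (pow_ne_zero 2 hk)]
    refine ae_eq_of_integral_trig hFm (memLp_const m) fun n θ => ?_
    by_cases hn : n = 0
    · subst hn
      simp only [Nat.cast_zero, zero_mul, zero_add, intervalIntegral.integral_mul_const,
        intervalIntegral.integral_const, hm, smul_eq_mul]
      have := Real.pi_ne_zero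
      field_simp
      ring
    · rw [integral_const_mul_cos _ hn, hFi, h n hn]; ring

/-! ### Cosine series in `H⁶` -/

namespace CosSeq

/-- The weighted sum that controls six derivatives. -/
def Smooth (a : CosSeq) : Prop := Summable fun n : ℕ => (1 + n : ℝ) ^ 6 * |coef n a|

/-- The termwise `j`-th derivative of a cosine series. -/
def dseries (j : ℕ) (a : CosSeq) (ξ : ℝ) : ℝ := ∑' n : ℕ, coef n a * trig n 0 j ξ

lemma abs_dseries_term_le {j : ℕ} (hj : j ≤ 6) (a : CosSeq) (n : ℕ) (ξ : ℝ) :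
    |coef n a * trig n 0 j ξ| ≤ (1 + n : ℝ) ^ 6 * |coef n a| := by
  rw [abs_mul, mul_comm]
  refine mul_le_mul_of_nonneg_right ((abs_trig_le _ _ _ _).trans ?_) (abs_nonneg _)
  have hn : (0 : ℝ) ≤ n := n.cast_nonneg
  rw [abs_of_nonneg hn]
  calc (n : ℝ) ^ j ≤ (1 + n) ^ j := by gcongr; linarith
    _ ≤ (1 + n) ^ 6 := pow_le_pow_right₀ (by linarith) hj

lemma abs_dseries_le {j : ℕ} (hj : j ≤ 6) {a : CosSeq} (ha : a.Smooth) (ξ : ℝ) :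
    |dseries j a ξ| ≤ ∑' n : ℕ, (1 + n : ℝ) ^ 6 * |coef n a| := by
  rw [← Real.norm_eq_abs]
  exact tsum_of_norm_bounded ha.hasSum fun n => abs_dseries_term_le hj a n ξ

lemma continuous_dseries {j : ℕ} (hj : j ≤ 6) {a : CosSeq} (ha : a.Smooth) :
    Continuous (dseries j a) :=
  continuous_tsum (fun n => continuous_const.mul (continuous_trig n 0 j)) ha
    fun n ξ => abs_dseries_term_le hj a n ξ

lemma periodic_dseries (j : ℕ) (a : CosSeq) : Function.Periodic (dseries j a) (2 * Real.pi) := by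
  intro ξ
  simp only [dseries, fun n : ℕ => periodic_trig n 0 j ξ]

/-- Both sides are integrated termwise, and for a single mode the identity is integration by parts.
The right side converges because n^j|aₙ| is summable for j ≤ 6. -/
lemma hasWeakDeriv_dseries {j : ℕ} (hj : j ≤ 6) {a : CosSeq} (ha : a.Smooth) :
    HasWeakDeriv j (toFun a) (dseries j a) := by
  intro φ hφ pφ
  have h1 := hasSum_integral_series a.summable_coef (g := fun n x => Real.cos (n * x))
    (fun n => by fun_prop) (fun n x => Real.abs_cos_le_one _)
    (contDiff_iteratedDeriv hφ j).continuous 0 (2 * Real.pi)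
  have hc : Summable fun n : ℕ => |coef n a * (n : ℝ) ^ j| := by
    refine Summable.of_nonneg_of_le (fun _ => abs_nonneg _) (fun n => ?_) ha
    rw [abs_mul, mul_comm, abs_of_nonneg (by positivity)]
    have hn : (0 : ℝ) ≤ n := n.cast_nonneg
    refine mul_le_mul_of_nonneg_right ?_ (abs_nonneg _)
    calc (n : ℝ) ^ j ≤ (1 + n) ^ j := by gcongr; linarith
      _ ≤ (1 + n) ^ 6 := pow_le_pow_right₀ (by linarith) hj
  have h2 := hasSum_integral_series hc
    (g := fun n x => Real.cos (n * x + 0 + j * (Real.pi / 2)))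
    (fun n => by fun_prop) (fun n x => Real.abs_cos_le_one _) hφ.continuous 0 (2 * Real.pi)
  have h3 := h2.mul_left ((-1) ^ j)
  have hd : ∀ x, ∑' n : ℕ, coef n a * (n : ℝ) ^ j *
      Real.cos (n * x + 0 + j * (Real.pi / 2)) = dseries j a x := fun x =>
    tsum_congr fun n => by simp only [trig]; ring
  simp only [hd] at h3
  refine h1.unique (Eq.subst (motive := fun f => HasSum f _) (funext fun n => ?_) h3)
  symm
  have h4 := integral_trig_mul_iteratedDeriv n 0 hφ pφ j 0
  rw [trig_zero, zero_add] at h4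
  simp only [add_zero] at h4
  rw [h4]
  simp only [trig, mul_assoc, intervalIntegral.integral_const_mul, add_zero]
  ring

lemma memL2per_dseries {j : ℕ} (hj : j ≤ 6) {a : CosSeq} (ha : a.Smooth) :
    MemL2per (dseries j a) :=
  ⟨periodic_dseries j a, memLp_of_continuous (continuous_dseries hj ha)⟩

lemma memH6per_toFun {a : CosSeq} (ha : a.Smooth) : MemH6per (toFun a) :=
  ⟨a.continuous_toFun, a.toFun_periodic,
    fun j hj => ⟨dseries j a, memL2per_dseries hj ha, hasWeakDeriv_dseries hj ha⟩⟩

/-- The weighted sum bounds each of the seven derivatives uniformly, and 14π = 7 · 2π. -/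
lemma h6norm_toFun_le {a : CosSeq} (ha : a.Smooth) :
    h6norm (toFun a) ≤ √(14 * Real.pi) * ∑' n : ℕ, (1 + n : ℝ) ^ 6 * |coef n a| := by
  set S := ∑' n : ℕ, (1 + n : ℝ) ^ 6 * |coef n a| with hS
  have hS0 : 0 ≤ S := tsum_nonneg fun n => by positivity
  have hpi := Real.pi_pos
  have h : ∀ j ∈ Finset.range 7,
      ∫ x in (0 : ℝ)..(2 * Real.pi), (weakDeriv j (toFun a) x) ^ 2 ≤ 2 * Real.pi * S ^ 2 := by
    intro j hj
    have hj6 : j ≤ 6 := by have := Finset.mem_range.1 hj; omega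
    have h1 : ∫ x in (0 : ℝ)..(2 * Real.pi), (weakDeriv j (toFun a) x) ^ 2 =
        ∫ x in (0 : ℝ)..(2 * Real.pi), (dseries j a x) ^ 2 := by
      apply intervalIntegral.integral_congr_ae_restrict
      rw [Set.uIoc_of_le (by positivity)]
      filter_upwards [weakDeriv_ae_eq (memL2per_dseries hj6 ha) (hasWeakDeriv_dseries hj6 ha)]
        with x hx
      rw [hx]
    have hc := continuous_dseries hj6 ha
    rw [h1]
    calc ∫ x in (0 : ℝ)..(2 * Real.pi), (dseries j a x) ^ 2
        ≤ ∫ x in (0 : ℝ)..(2 * Real.pi), S ^ 2 := by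
          apply intervalIntegral.integral_mono_on (by positivity)
            ((by fun_prop : Continuous fun x => dseries j a x ^ 2).intervalIntegrable _ _)
            (continuous_const.intervalIntegrable _ _)
          intro x _
          rw [← sq_abs]
          exact pow_le_pow_left₀ (abs_nonneg _) (abs_dseries_le hj6 ha x) 2
      _ = 2 * Real.pi * S ^ 2 := by simp
  rw [h6norm]
  calc _ ≤ √(14 * Real.pi * S ^ 2) := by
        apply Real.sqrt_le_sqrt
        refine (Finset.sum_le_sum h).trans (le_of_eq ?_)
        simp; ring
    _ = _ := by rw [Real.sqrt_mul (by positivity), Real.sqrt_sq hS0]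

end CosSeq

/-! ### Fourier decay of `H⁶` functions and passage to coefficient sequences -/

lemma h6norm_nonneg (u : ℝ → ℝ) : 0 ≤ h6norm u := Real.sqrt_nonneg _

/-- Bessel's inequality for the sixth weak derivative, whose integral against cos(nx) is -πn⁶ times
the coefficient of `u`. -/
lemma abs_cosCoeff_le_h6norm {u : ℝ → ℝ} (hu : MemH6per u) (n : ℕ) :
    (n : ℝ) ^ 6 * |cosCoeff n u| ≤ h6norm u := by
  by_cases hn : n = 0
  · subst hn; simpa using h6norm_nonneg u
  obtain ⟨h1, h2⟩ := weakDeriv_spec (hu.weakDeriv 6 le_rfl)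
  set w := weakDeriv 6 u
  have hpi := Real.pi_pos
  have hV : ∫ x in (0 : ℝ)..(2 * Real.pi), w x ^ 2 ≤ h6norm u ^ 2 := by
    have h0 : ∀ j ∈ Finset.range 7,
        0 ≤ ∫ x in (0 : ℝ)..(2 * Real.pi), (weakDeriv j u x) ^ 2 := fun j _ =>
      intervalIntegral.integral_nonneg (by positivity) fun x _ => sq_nonneg _
    rw [h6norm, Real.sq_sqrt (Finset.sum_nonneg h0)]
    exact Finset.single_le_sum h0 (Finset.mem_range.2 (by norm_num : 6 < 7))
  set I := ∫ x in (0 : ℝ)..(2 * Real.pi), w x * Real.cos (n * x) with hI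
  have hIc : I = -((n : ℝ) ^ 6 * (Real.pi * cosCoeff n u)) := by
    have h3 := h2.integral_trig n 0
    have h4 : ∀ x, u x * trig n 0 6 x = -(n : ℝ) ^ 6 * (u x * Real.cos (n * x)) := by
      intro x; rw [trig_six]; ring_nf
    simp_rw [h4, add_zero] at h3
    rw [intervalIntegral.integral_const_mul] at h3
    rw [cosCoeff, ← mul_assoc Real.pi, mul_one_div_cancel hpi.ne', one_mul]
    linarith
  have iw := intervalIntegrable_of_memLp h1.2
  have iw2 : IntervalIntegrable (fun x => w x ^ 2) volume 0 (2 * Real.pi) := by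
    rw [intervalIntegrable_iff_integrableOn_Ioc_of_le (by positivity)]
    exact h1.2.integrable_sq
  have iwc : IntervalIntegrable (fun x => w x * Real.cos (n * x)) volume 0 (2 * Real.pi) :=
    iw.mul_continuousOn (by fun_prop)
  have icc : IntervalIntegrable (fun x => Real.cos (n * x) * Real.cos (n * x)) volume 0
    (2 * Real.pi) := by apply Continuous.intervalIntegrable; fun_prop
  have hCS : I ^ 2 ≤ Real.pi * h6norm u ^ 2 := by
    -- Cauchy–Schwarz, as nonnegativity of the squared distance from `w` to its projection on
    -- cos(nx).
    have h0 : 0 ≤ ∫ x in (0 : ℝ)..(2 * Real.pi), (w x - I / Real.pi * Real.cos (n * x)) ^ 2 :=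
      intervalIntegral.integral_nonneg (by positivity) fun x _ => sq_nonneg _
    have h5 : ∀ x, (w x - I / Real.pi * Real.cos (n * x)) ^ 2 =
        w x ^ 2 - 2 * (I / Real.pi) * (w x * Real.cos (n * x)) +
          (I / Real.pi) ^ 2 * (Real.cos (n * x) * Real.cos (n * x)) := by intro x; ring
    simp_rw [h5] at h0
    rw [intervalIntegral.integral_add (iw2.sub (iwc.const_mul _)) (icc.const_mul _),
      intervalIntegral.integral_sub iw2 (iwc.const_mul _), intervalIntegral.integral_const_mul,
      intervalIntegral.integral_const_mul, integral_cos_mul_cos, if_pos rfl, if_neg hn, ← hI] at h0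
    have h6 : 2 * (I / Real.pi) * I - (I / Real.pi) ^ 2 * Real.pi = I ^ 2 / Real.pi := by
      field_simp; ring
    have h7 : I ^ 2 / Real.pi ≤ h6norm u ^ 2 := by linarith
    rw [div_le_iff₀ hpi] at h7
    linarith
  have h8 : ((n : ℝ) ^ 6 * |cosCoeff n u|) ^ 2 * Real.pi ≤ h6norm u ^ 2 := by
    have : I ^ 2 = Real.pi * (((n : ℝ) ^ 6 * |cosCoeff n u|) ^ 2 * Real.pi) := by
      rw [hIc, mul_pow _ |cosCoeff n u|, sq_abs]; ring
    rw [this] at hCS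
    exact le_of_mul_le_mul_left hCS hpi
  have h9 : ((n : ℝ) ^ 6 * |cosCoeff n u|) ^ 2 ≤ h6norm u ^ 2 := by
    refine le_trans ?_ h8
    exact le_mul_of_one_le_right (sq_nonneg _) (by linarith [Real.pi_gt_three])
  exact le_of_sq_le_sq h9 (h6norm_nonneg u)

lemma summable_four_div_pow : Summable fun n : ℕ => 4 / (n : ℝ) ^ 4 := by
  simpa [div_eq_mul_inv] using (Real.summable_nat_pow_inv (p := 4)).2 (by norm_num) |>.mul_left 4

/-- Continuous `2π`-periodic functions that agree almost everywhere on a period are equal. -/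
lemma eq_of_ae_eq_period {f g : ℝ → ℝ} (hf : Continuous f) (hg : Continuous g)
    (pf : Function.Periodic f (2 * Real.pi)) (pg : Function.Periodic g (2 * Real.pi))
    (h : f =ᵐ[volume.restrict (Set.Ioc 0 (2 * Real.pi))] g) : f = g := by
  have hpi : (0 : ℝ) < 2 * Real.pi := by positivity
  have h1 : Set.EqOn f g (Set.Ioc 0 (2 * Real.pi)) :=
    Measure.eqOn_Ioc_of_ae_eq volume h hf.continuousOn hg.continuousOn
  ext x
  obtain ⟨y, hy, hxy⟩ := (pf.sub pg).exists_mem_Ioc hpi x 0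
  rw [zero_add] at hy
  simp only [Pi.sub_apply, h1 hy, sub_self] at hxy
  linarith

/-- An even `H⁶` function of mean zero is a cosine series, with control of the norm. -/
lemma exists_cosSeq {u : ℝ → ℝ} (hu : MemH6per u) (he : ∀ ξ, u (-ξ) = u ξ)
    (hm : ∫ ξ in (0 : ℝ)..(2 * Real.pi), u ξ = 0) :
    ∃ a : CosSeq, a.toFun = u ∧ CosSeq.coef 0 a = 0 ∧
      ‖a‖ ≤ (∑' n : ℕ, 4 / (n : ℝ) ^ 4) * h6norm u := by
  have hc0 : cosCoeff 0 u = 0 := by simp [cosCoeff, hm]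
  have hb : ∀ n : ℕ, |(1 + n : ℝ) ^ 2 * cosCoeff n u| ≤ 4 / (n : ℝ) ^ 4 * h6norm u := by
    intro n
    by_cases hn : n = 0
    -- Division by zero makes the right side 0 here, so the vanishing mean is essential.
    · subst hn; simp [hc0]
    have h1 := abs_cosCoeff_le_h6norm hu n
    have hn1 : (1 : ℝ) ≤ n := by exact_mod_cast Nat.one_le_iff_ne_zero.2 hn
    rw [abs_mul, abs_of_nonneg (by positivity), div_mul_eq_mul_div, le_div_iff₀ (by positivity)]
    calc (1 + n : ℝ) ^ 2 * |cosCoeff n u| * n ^ 4 ≤ (2 * n) ^ 2 * |cosCoeff n u| * n ^ 4 := by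
          gcongr; linarith
      _ = 4 * (n ^ 6 * |cosCoeff n u|) := by ring
      _ ≤ 4 * h6norm u := by linarith
  have hs := summable_four_div_pow.mul_right (h6norm u)
  refine ⟨CosSeq.mk' (fun n => (1 + n : ℝ) ^ 2 * cosCoeff n u)
    (Summable.of_nonneg_of_le (fun _ => abs_nonneg _) hb hs), ?_, ?_, ?_⟩
  · set a := CosSeq.mk' (fun n => (1 + n : ℝ) ^ 2 * cosCoeff n u)
      (Summable.of_nonneg_of_le (fun _ => abs_nonneg _) hb hs) with ha
    have hcoef : ∀ n, CosSeq.coef n a = cosCoeff n u := fun n => by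
      rw [CosSeq.coef, ha, CosSeq.mk'_apply, mul_div_cancel_left₀ _ (CosSeq.weight_pos n).ne']
    refine eq_of_ae_eq_period a.continuous_toFun hu.continuous a.toFun_periodic hu.periodic
      (ae_eq_of_integral_trig (memLp_of_continuous a.continuous_toFun) hu.memL2per.2
        fun n θ => ?_)
    rw [integral_even_mul_cos a.continuous_toFun a.toFun_even a.toFun_periodic,
      integral_even_mul_cos hu.continuous he hu.periodic]
    by_cases hn : n = 0
    · subst hn
      rw [hc0, cosCoeff]
      simp [CosSeq.integral_toFun, hcoef, hc0]
    · rw [CosSeq.cosCoeff_toFun _ hn, hcoef]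
  · simp [CosSeq.coef, hc0]
  · rw [CosSeq.norm_eq, ← tsum_mul_right]
    exact (Summable.of_nonneg_of_le (fun _ => abs_nonneg _) hb hs).tsum_le_tsum hb hs

namespace CosSeq

local infixl:70 " ⋆ " => mul

/-! ### Explicit products -/

/-- cos²ξ = (1 + cos 2ξ)/2. No factor 1/2 precedes `coef 0 w` because the constant mode integrates
to 2π instead of π. -/
lemma coef_one_e_mul (w : CosSeq) : coef 1 (e 1 ⋆ w) = coef 0 w + (1 / 2) * coef 2 w := by
  rw [← cosCoeff_toFun _ one_ne_zero, cosCoeff]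
  have h : ∀ x, toFun (e 1 ⋆ w) x * Real.cos ((1 : ℕ) * x) =
      (1 / 2) * (toFun w x * Real.cos ((0 : ℕ) * x) + toFun w x * Real.cos ((2 : ℕ) * x)) := by
    intro x
    simp only [toFun_mul, toFun_e, Nat.cast_one, Nat.cast_zero, Nat.cast_ofNat, one_mul, zero_mul,
      Real.cos_zero, Real.cos_two_mul]
    ring
  have hc := w.continuous_toFun
  simp_rw [h]
  rw [intervalIntegral.integral_const_mul, intervalIntegral.integral_add
    (by apply Continuous.intervalIntegrable; fun_prop)
    (by apply Continuous.intervalIntegrable; fun_prop), integral_toFun_mul_cos,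
    integral_toFun_mul_cos, if_pos rfl, if_neg two_ne_zero]
  field_simp

lemma coef_two_e_mul (w : CosSeq) :
    coef 2 (e 1 ⋆ w) = (1 / 2) * (coef 1 w + coef 3 w) := by
  rw [← cosCoeff_toFun _ two_ne_zero, cosCoeff]
  have h : ∀ x, toFun (e 1 ⋆ w) x * Real.cos ((2 : ℕ) * x) =
      (1 / 2) * (toFun w x * Real.cos ((1 : ℕ) * x) + toFun w x * Real.cos ((3 : ℕ) * x)) := by
    intro x
    simp only [toFun_mul, toFun_e, Nat.cast_one, Nat.cast_ofNat, one_mul, Real.cos_two_mul,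
      Real.cos_three_mul]
    ring
  have hc := w.continuous_toFun
  simp_rw [h]
  rw [intervalIntegral.integral_const_mul, intervalIntegral.integral_add
    (by apply Continuous.intervalIntegrable; fun_prop)
    (by apply Continuous.intervalIntegrable; fun_prop), integral_toFun_mul_cos,
    integral_toFun_mul_cos, if_neg one_ne_zero, if_neg three_ne_zero]
  field_simp

lemma cos_four_mul (x : ℝ) : Real.cos (4 * x) = 2 * (2 * Real.cos x ^ 2 - 1) ^ 2 - 1 := by
  rw [show 4 * x = 2 * (2 * x) by ring, Real.cos_two_mul, Real.cos_two_mul]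

lemma e_one_sq : e 1 ⋆ e 1 = (1 / 2 : ℝ) • (e 0 + e 2) := by
  refine ext_toFun fun x => ?_
  simp [Real.cos_two_mul]; ring

lemma e_one_cube : e 1 ⋆ (e 1 ⋆ e 1) = (3 / 4 : ℝ) • e 1 + (1 / 4 : ℝ) • e 3 := by
  refine ext_toFun fun x => ?_
  simp [Real.cos_three_mul]; ring

lemma e_two_sq : e 2 ⋆ e 2 = (1 / 2 : ℝ) • (e 0 + e 4) := by
  refine ext_toFun fun x => ?_
  simp [Real.cos_two_mul, cos_four_mul]; ring

lemma e_one_sq_mul_e_two :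
    e 1 ⋆ (e 1 ⋆ e 2) = (1 / 4 : ℝ) • (e 0 + e 4) + (1 / 2 : ℝ) • e 2 := by
  refine ext_toFun fun x => ?_
  simp [Real.cos_two_mul, cos_four_mul]; ring

lemma norm_e_one : ‖e 1‖ = 4 := by rw [norm_e]; norm_num

/-! ### The fixed point equation on the noncritical modes -/

/-- `d` inverts the multiplier `lam` on all modes from the second on, and vanishes on the
first two. -/
structure IsInv (d lam : ℕ → ℝ) : Prop where
  zero : d 0 = 0
  one : d 1 = 0
  le : ∀ n, |d n| ≤ 1 / 4
  decay : ∀ n : ℕ, (n : ℝ) ^ 4 * |d n| ≤ 4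
  inv : ∀ n, 2 ≤ n → d n * lam n = 1

/-- The rescaled nonlinearity `s y² + A y³`. -/
def nonlin (s A : ℝ) (y : CosSeq) : CosSeq := s • (y ⋆ y) + A • (y ⋆ (y ⋆ y))

/-- The radius of the ball in which the fixed point problem is solved. -/
def radius (s : ℝ) : ℝ := 25 * |s| + 125

lemma radius_ge (s : ℝ) : 125 ≤ radius s := by
  rw [radius]; linarith [abs_nonneg s]

lemma norm_mul_le_of_le {a b : CosSeq} {x y : ℝ} (ha : ‖a‖ ≤ x) (hb : ‖b‖ ≤ y) :
    ‖a ⋆ b‖ ≤ x * y :=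
  (norm_mul_le a b).trans (mul_le_mul ha hb (norm_nonneg _) ((norm_nonneg _).trans ha))

lemma norm_smul_le_of_le {a : CosSeq} {t x y : ℝ} (ht : |t| ≤ x) (ha : ‖a‖ ≤ y) :
    ‖t • a‖ ≤ x * y := by
  rw [norm_smul, Real.norm_eq_abs]
  exact mul_le_mul ht ha (norm_nonneg _) ((abs_nonneg _).trans ht)

lemma norm_cube_sub_le {y z : CosSeq} (hy : ‖y‖ ≤ 5) (hz : ‖z‖ ≤ 5) :
    ‖y ⋆ (y ⋆ y) - z ⋆ (z ⋆ z)‖ ≤ 75 * ‖y - z‖ := by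
  have h : y ⋆ (y ⋆ y) - z ⋆ (z ⋆ z) = (y - z) ⋆ (y ⋆ y + y ⋆ z + z ⋆ z) := by
    refine ext_toFun fun x => ?_
    simp; ring
  rw [h, mul_comm]
  refine norm_mul_le_of_le le_rfl ?_
  have := norm_add₃_le (a := y ⋆ y) (b := y ⋆ z) (c := z ⋆ z)
  linarith [norm_mul_le_of_le hy hy, norm_mul_le_of_le hy hz, norm_mul_le_of_le hz hz]

lemma norm_cube_le {y : CosSeq} (hy : ‖y‖ ≤ 5) : ‖y ⋆ (y ⋆ y)‖ ≤ 125 := by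
  have := norm_mul_le_of_le hy (norm_mul_le_of_le hy hy)
  linarith

/-- This bound explains `radius`: 25|s| comes from the square and 125 from the cube on the ball of
radius 5. -/
lemma norm_nonlin_le {s A : ℝ} {y : CosSeq} (hA : |A| ≤ 1) (hy : ‖y‖ ≤ 5) :
    ‖nonlin s A y‖ ≤ radius s := by
  have h1 := norm_smul_le_of_le (le_refl |s|) (norm_mul_le_of_le hy hy)
  have h2 := norm_smul_le_of_le hA (norm_cube_le hy)
  have := norm_add_le (s • (y ⋆ y)) (A • (y ⋆ (y ⋆ y)))
  rw [nonlin, radius]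
  linarith

/-- Two amplitudes are allowed so that one estimate yields both the contraction in `w` and the
Lipschitz dependence on the amplitude. -/
lemma norm_nonlin_sub_le {s A B : ℝ} {y z : CosSeq} (hB : |B| ≤ 1) (hy : ‖y‖ ≤ 5)
    (hz : ‖z‖ ≤ 5) :
    ‖nonlin s A y - nonlin s B z‖ ≤ radius s * (‖y - z‖ + |A - B|) := by
  have h : nonlin s A y - nonlin s B z = s • ((y - z) ⋆ (y + z)) + (A - B) • (y ⋆ (y ⋆ y)) +
      B • (y ⋆ (y ⋆ y) - z ⋆ (z ⋆ z)) := by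
    refine ext_toFun fun x => ?_
    simp [nonlin]; ring
  have h0 : ‖y + z‖ ≤ 10 := (norm_add_le _ _).trans (by linarith)
  have h1 := norm_smul_le_of_le (le_refl |s|) (norm_mul_le_of_le (le_refl ‖y - z‖) h0)
  have h2 := norm_smul_le_of_le (le_refl |A - B|) (norm_cube_le hy)
  have h3 := norm_smul_le_of_le hB (norm_cube_sub_le hy hz)
  rw [h]
  refine norm_add₃_le.trans ?_
  rw [radius]
  have := mul_nonneg (abs_nonneg s) (norm_nonneg (y - z))
  have := mul_nonneg (abs_nonneg s) (abs_nonneg (A - B))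
  nlinarith [norm_nonneg (y - z)]

lemma norm_diag_le {d lam : ℕ → ℝ} (hd : IsInv d lam) (a : CosSeq) :
    ‖diag d (1 / 4) hd.le a‖ ≤ 1 / 4 * ‖a‖ :=
  norm_le_of_coef fun n => by
    rw [coef_diag, abs_mul]
    exact mul_le_mul_of_nonneg_right (hd.le n) (abs_nonneg _)

lemma diag_sub {d : ℕ → ℝ} {K : ℝ} (hd : ∀ n, |d n| ≤ K) (a b : CosSeq) :
    diag d K hd (a - b) = diag d K hd a - diag d K hd b :=
  ext_coef fun n => by simp only [coef_diag, coef_sub]; ring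

/-- The map whose fixed points `w` give the noncritical part `A² w` of solutions. -/
def step (s : ℝ) {d lam : ℕ → ℝ} (hd : IsInv d lam) (A : ℝ) (w : CosSeq) : CosSeq :=
  -diag d (1 / 4) hd.le (nonlin s A (e 1 + A • w))

/-- 5 = 4 + 1: `e 1` has norm 4, and |A| · `radius s` ≤ 1 bounds the correction. -/
lemma norm_profile_le {s A : ℝ} {w : CosSeq} (hA : |A| * radius s ≤ 1) (hw : ‖w‖ ≤ radius s) :
    ‖e 1 + A • w‖ ≤ 5 := by
  have h1 := norm_smul_le_of_le (le_refl |A|) hw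
  have := norm_add_le (e 1) (A • w)
  rw [norm_e_one] at this
  linarith

lemma abs_le_one_of_radius {s A : ℝ} (hA : |A| * radius s ≤ 1) : |A| ≤ 1 := by
  nlinarith [radius_ge s, abs_nonneg A]

lemma norm_step_le {s : ℝ} {d lam : ℕ → ℝ} (hd : IsInv d lam) {A : ℝ} {w : CosSeq}
    (hA : |A| * radius s ≤ 1) (hw : ‖w‖ ≤ radius s) : ‖step s hd A w‖ ≤ radius s := by
  rw [step, norm_neg]
  have := norm_nonlin_le (s := s) (abs_le_one_of_radius hA) (norm_profile_le hA hw)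
  linarith [norm_diag_le hd (nonlin s A (e 1 + A • w)), radius_ge s]

lemma norm_profile_sub_le {s A B : ℝ} {w z : CosSeq} (hw : ‖w‖ ≤ radius s) :
    ‖(e 1 + A • w) - (e 1 + B • z)‖ ≤ radius s * |A - B| + |B| * ‖w - z‖ := by
  have h : (e 1 + A • w) - (e 1 + B • z) = (A - B) • w + B • (w - z) := by module
  rw [h]
  refine (norm_add_le _ _).trans ?_
  have h1 := norm_smul_le_of_le (le_refl |A - B|) hw
  have h2 := norm_smul_le_of_le (le_refl |B|) (le_refl ‖w - z‖)
  linarith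

/-- The inverse contributes 1/4 and the nonlinearity `radius s`, which the factor |B| in front of w
- z absorbs. For `A = B` this is a contraction. -/
lemma norm_step_sub_le {s : ℝ} {d lam : ℕ → ℝ} (hd : IsInv d lam) {A B : ℝ} {w z : CosSeq}
    (hA : |A| * radius s ≤ 1) (hB : |B| * radius s ≤ 1) (hw : ‖w‖ ≤ radius s)
    (hz : ‖z‖ ≤ radius s) :
    ‖step s hd A w - step s hd B z‖ ≤ radius s ^ 2 * |A - B| + 1 / 2 * ‖w - z‖ := by
  have h : step s hd A w - step s hd B z = -diag d (1 / 4) hd.le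
      (nonlin s A (e 1 + A • w) - nonlin s B (e 1 + B • z)) := by
    rw [diag_sub, step, step]; abel
  rw [h, norm_neg]
  have h1 := norm_diag_le hd (nonlin s A (e 1 + A • w) - nonlin s B (e 1 + B • z))
  have h2 := norm_nonlin_sub_le (s := s) (A := A) (abs_le_one_of_radius hB) (norm_profile_le hA hw)
    (norm_profile_le hB hz)
  have h3 := norm_profile_sub_le (A := A) (B := B) (z := z) hw
  have hR := radius_ge s
  have h4 : radius s * (‖(e 1 + A • w) - (e 1 + B • z)‖ + |A - B|) ≤
      radius s * ((radius s * |A - B| + |B| * ‖w - z‖) + |A - B|) := by gcongr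
  have h5 : |B| * radius s * ‖w - z‖ ≤ 1 * ‖w - z‖ := by gcongr
  have h6 : radius s * |A - B| ≤ radius s ^ 2 * |A - B| := by
    gcongr; nlinarith
  nlinarith [norm_nonneg (w - z), abs_nonneg (A - B)]

lemma exists_fixedPoint (s : ℝ) {d lam : ℕ → ℝ} (hd : IsInv d lam) {A : ℝ}
    (hA : |A| * radius s ≤ 1) : ∃ w : CosSeq, ‖w‖ ≤ radius s ∧ step s hd A w = w := by
  have hR := radius_ge s
  set S : Set CosSeq := Metric.closedBall 0 (radius s) with hS
  have hmem : ∀ w, w ∈ S ↔ ‖w‖ ≤ radius s := fun w => by simp [hS]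
  have hmaps : Set.MapsTo (step s hd A) S S := fun w hw => by
    rw [hmem] at hw ⊢; exact norm_step_le hd hA hw
  have hcontr : ContractingWith (1 / 2) (hmaps.restrict (step s hd A) S S) := by
    refine ⟨by rw [← NNReal.coe_lt_coe]; norm_num, LipschitzWith.of_dist_le_mul fun x y => ?_⟩
    have := norm_step_sub_le hd hA hA ((hmem _).1 x.2) ((hmem _).1 y.2)
    simp only [sub_self, abs_zero, mul_zero, zero_add] at this
    rw [Subtype.dist_eq, Subtype.dist_eq, dist_eq_norm, dist_eq_norm]
    simpa using this
  obtain ⟨w, hw, hfix, -⟩ := hcontr.exists_fixedPoint' (Metric.isClosed_closedBall.isComplete)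
    hmaps (x := 0) ((hmem 0).2 (by rw [norm_zero]; linarith)) (edist_ne_top _ _)
  exact ⟨w, (hmem w).1 hw, hfix⟩

/-- The term ‖w - z‖/2 is absorbed on the left. For `A = B` this is uniqueness of the fixed point in
the ball. -/
lemma norm_fixedPoint_sub_le {s : ℝ} {d lam : ℕ → ℝ} (hd : IsInv d lam) {A B : ℝ} {w z : CosSeq}
    (hA : |A| * radius s ≤ 1) (hB : |B| * radius s ≤ 1) (hw : ‖w‖ ≤ radius s)
    (hz : ‖z‖ ≤ radius s) (fw : step s hd A w = w) (fz : step s hd B z = z) :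
    ‖w - z‖ ≤ 2 * radius s ^ 2 * |A - B| := by
  have := norm_step_sub_le hd hA hB hw hz
  rw [fw, fz] at this
  linarith

/-! ### The amplitude function -/

/-- The function `h` in the bifurcation equation `A² h = ε² (1 - 4 ω²)`. -/
def ampl (s A : ℝ) (w : CosSeq) : ℝ :=
  2 * s * coef 1 (e 1 ⋆ w) + s * A * coef 1 (w ⋆ w) +
    coef 1 ((e 1 + A • w) ⋆ ((e 1 + A • w) ⋆ (e 1 + A • w)))

/-- The A² term is s cos², which has only modes zero and two, so mode one of the nonlinearity starts
at A³. This makes the bifurcation a pitchfork. -/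
lemma coef_one_nonlin (s A : ℝ) (w : CosSeq) :
    coef 1 (nonlin s 1 (A • (e 1 + A • w))) = A ^ 3 * ampl s A w := by
  have h : nonlin s 1 (A • (e 1 + A • w)) = (s * A ^ 2) • (e 1 ⋆ e 1) +
      (2 * s * A ^ 3) • (e 1 ⋆ w) + (s * A ^ 4) • (w ⋆ w) +
      A ^ 3 • ((e 1 + A • w) ⋆ ((e 1 + A • w) ⋆ (e 1 + A • w))) := by
    refine ext_toFun fun x => ?_
    simp [nonlin]; ring
  rw [h, e_one_sq]
  simp only [coef_add, coef_smul, coef_e, ampl]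
  norm_num
  ring

/-- `ampl` is polynomial in `A` and `w`, and fixed points are themselves Lipschitz in `A`. -/
lemma abs_ampl_sub_le {s : ℝ} {d lam : ℕ → ℝ} (hd : IsInv d lam) {A B : ℝ} {w z : CosSeq}
    (hA : |A| * radius s ≤ 1) (hB : |B| * radius s ≤ 1) (hw : ‖w‖ ≤ radius s)
    (hz : ‖z‖ ≤ radius s) (fw : step s hd A w = w) (fz : step s hd B z = z) :
    |ampl s A w - ampl s B z| ≤ 10 * radius s ^ 3 * |A - B| := by
  set R := radius s with hR
  have hR1 : 125 ≤ R := radius_ge s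
  have hsR : 25 * |s| ≤ R := by rw [hR, radius]; linarith
  have hwz := norm_fixedPoint_sub_le hd hA hB hw hz fw fz
  set D := ‖w - z‖ with hD
  have hD0 : 0 ≤ D := norm_nonneg _
  set t := |A - B| with ht
  have ht0 : 0 ≤ t := abs_nonneg _
  have h : ampl s A w - ampl s B z = coef 1 ((2 * s) • (e 1 ⋆ (w - z))) +
      coef 1 (s • ((A - B) • (w ⋆ w) + B • ((w - z) ⋆ (w + z)))) +
      coef 1 ((e 1 + A • w) ⋆ ((e 1 + A • w) ⋆ (e 1 + A • w)) -
        (e 1 + B • z) ⋆ ((e 1 + B • z) ⋆ (e 1 + B • z))) := by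
    have h1 : e 1 ⋆ (w - z) = e 1 ⋆ w - e 1 ⋆ z := by
      refine ext_toFun fun x => ?_
      simp; ring
    have h2 : (w - z) ⋆ (w + z) = w ⋆ w - z ⋆ z := by
      refine ext_toFun fun x => ?_
      simp; ring
    simp only [h1, h2, coef_add, coef_sub, coef_smul, ampl]
    ring
  have b1 : ‖(2 * s) • (e 1 ⋆ (w - z))‖ ≤ R * D := by
    have := norm_smul_le_of_le (t := 2 * s) (x := 2 * |s|) (by rw [abs_mul, abs_two])
      (norm_mul_le_of_le norm_e_one.le (le_refl ‖w - z‖))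
    refine this.trans ?_
    rw [← hD]
    nlinarith
  have b2 : ‖s • ((A - B) • (w ⋆ w) + B • ((w - z) ⋆ (w + z)))‖ ≤ R * (R ^ 2 * t + 2 * D) := by
    refine norm_smul_le_of_le (by linarith [abs_nonneg s]) ?_
    refine (norm_add_le _ _).trans ?_
    have h1 := norm_smul_le_of_le (le_refl |A - B|) (norm_mul_le_of_le hw hw)
    have h0 : ‖w + z‖ ≤ 2 * R := (norm_add_le _ _).trans (by linarith)
    have h2 := norm_smul_le_of_le (le_refl |B|) (norm_mul_le_of_le (le_refl ‖w - z‖) h0)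
    rw [← hD] at h2
    rw [← ht] at h1
    have h3 : |B| * R * D ≤ 1 * D := by gcongr
    nlinarith
  have b3 := norm_cube_sub_le (norm_profile_le hA hw) (norm_profile_le hB hz)
  have b4 := norm_profile_sub_le (A := A) (B := B) (z := z) hw
  rw [← hD, ← ht, ← hR] at b4
  have b5 : |B| * D ≤ D := mul_le_of_le_one_left hD0 (abs_le_one_of_radius hB)
  have b6 : ‖(e 1 + A • w) ⋆ ((e 1 + A • w) ⋆ (e 1 + A • w)) -
        (e 1 + B • z) ⋆ ((e 1 + B • z) ⋆ (e 1 + B • z))‖ ≤ R * (R * t + D) := by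
    refine b3.trans ?_
    have : 0 ≤ R * t + D := by positivity
    nlinarith
  rw [h]
  refine (abs_add_three _ _ _).trans ?_
  have c1 := (abs_coef_le 1 _).trans b1
  have c2 := (abs_coef_le 1 _).trans b2
  have c3 := (abs_coef_le 1 _).trans b6
  have c4 : R * D ≤ R * (2 * R ^ 2 * t) := by gcongr
  have c5 : R ^ 2 * t ≤ R ^ 3 * t := by
    gcongr
    · linarith
    · norm_num
  linarith

/-! ### Leading order of fixed points -/

/-- At leading order `w` is minus the inverse applied to s cos² = s(1 + cos 2ξ)/2, and `d 0 = 0`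
leaves only mode two. The remainder `g` is O(A), but its first-order part has only odd modes, so its
mode two is O(A²). -/
lemma exists_remainder {s : ℝ} {d lam : ℕ → ℝ} (hd : IsInv d lam) {A : ℝ} {w : CosSeq}
    (hA : |A| * radius s ≤ 1) (hw : ‖w‖ ≤ radius s) (fw : step s hd A w = w) :
    ∃ g : CosSeq, ‖g‖ ≤ 2 * radius s ^ 2 * |A| ∧
      w = (-(s * d 2 / 2)) • e 2 - diag d (1 / 4) hd.le g ∧
      |coef 2 g| ≤ 4 * radius s ^ 3 * A ^ 2 := by
  set R := radius s with hR
  have hR1 : 125 ≤ R := radius_ge s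
  have hsR : 25 * |s| ≤ R := by rw [hR, radius]; linarith
  have hA0 : 0 ≤ |A| := abs_nonneg A
  have hA1 := abs_le_one_of_radius hA
  have hy := norm_profile_le hA hw
  set y := e 1 + A • w with hydef
  set g : CosSeq := s • ((2 * A) • (e 1 ⋆ w) + A ^ 2 • (w ⋆ w)) + A • (y ⋆ (y ⋆ y)) with hg
  have hA2 : |A ^ 2| * R ≤ |A| := by
    rw [abs_pow]; nlinarith
  have hgn : ‖g‖ ≤ 2 * R ^ 2 * |A| := by
    have h1 := norm_smul_le_of_le (t := 2 * A) (x := 2 * |A|) (by rw [abs_mul, abs_two])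
      (norm_mul_le_of_le norm_e_one.le hw)
    have h2 := norm_smul_le_of_le (le_refl |A ^ 2|) (norm_mul_le_of_le hw hw)
    have h3 := norm_smul_le_of_le (le_refl |A|) (norm_cube_le hy)
    have h4 := norm_add_le ((2 * A) • (e 1 ⋆ w)) (A ^ 2 • (w ⋆ w))
    have h5 := norm_smul_le_of_le (le_refl |s|) h4
    have h6 := norm_add_le (s • ((2 * A) • (e 1 ⋆ w) + A ^ 2 • (w ⋆ w))) (A • (y ⋆ (y ⋆ y)))
    have h7 : |A ^ 2| * (R * R) ≤ |A| * R := by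
      have : |A ^ 2| * R * R ≤ |A| * R := by gcongr
      linarith
    have h8 : ‖(2 * A) • (e 1 ⋆ w)‖ + ‖A ^ 2 • (w ⋆ w)‖ ≤ 9 * R * |A| := by linarith
    have h9 : |s| * (‖(2 * A) • (e 1 ⋆ w)‖ + ‖A ^ 2 • (w ⋆ w)‖) ≤ R / 25 * (9 * R * |A|) := by
      gcongr; linarith
    have h10 : |A| * 125 ≤ R ^ 2 * |A| := by
      rw [mul_comm]
      gcongr
      nlinarith
    have h11 : 0 ≤ R ^ 2 * |A| := by positivity
    rw [hg]
    linarith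
  have hrep : w = (-(s * d 2 / 2)) • e 2 - diag d (1 / 4) hd.le g := by
    have h1 : nonlin s A y = s • ((1 / 2 : ℝ) • (e 0 + e 2)) + g := by
      rw [← e_one_sq]
      refine ext_toFun fun x => ?_
      simp [nonlin, hg, hydef]; ring
    refine ext_coef fun n => ?_
    conv_lhs => rw [← fw, step, ← hydef, h1]
    simp only [coef_neg, coef_sub, coef_diag, coef_add, coef_smul, coef_e]
    by_cases h0 : n = 0
    · subst h0; simp [hd.zero]
    · by_cases h2 : n = 2
      · subst h2; simp; ring
      · simp [h0, h2]
  refine ⟨g, hgn, hrep, ?_⟩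
  have hw1 : coef 1 w = 0 := by
    rw [hrep]; simp [coef_diag, coef_e, hd.one]
  have hw3 : |coef 3 w| ≤ R ^ 2 * |A| := by
    rw [hrep]
    simp only [coef_sub, coef_smul, coef_e, coef_diag]
    rw [if_neg (by norm_num), mul_zero, zero_sub, abs_neg, abs_mul]
    have h1 := hd.le 3
    have h2 := abs_coef_le 3 g
    have := mul_le_mul h1 (h2.trans hgn) (abs_nonneg _) (by norm_num)
    have : 0 ≤ R ^ 2 * |A| := by positivity
    linarith
  have hcube : |coef 2 (y ⋆ (y ⋆ y))| ≤ R ^ 2 * |A| := by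
    have h1 : coef 2 (y ⋆ (y ⋆ y)) = coef 2 (y ⋆ (y ⋆ y) - e 1 ⋆ (e 1 ⋆ e 1)) := by
      rw [coef_sub, e_one_cube]; simp [coef_e]
    have h2 : ‖y - e 1‖ ≤ |A| * R := by
      rw [hydef, add_sub_cancel_left]; exact norm_smul_le_of_le le_rfl hw
    rw [h1]
    refine (abs_coef_le _ _).trans
      ((norm_cube_sub_le hy (norm_e_one.le.trans (by norm_num))).trans ?_)
    nlinarith [mul_nonneg hA0 (by linarith : (0 : ℝ) ≤ R)]
  -- Mode two of cos ξ · w sees only modes one and three of `w`: the first vanishes and the other is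
  -- O(A).
  have hcg : coef 2 g = s * (A * coef 3 w + A ^ 2 * coef 2 (w ⋆ w)) +
      A * coef 2 (y ⋆ (y ⋆ y)) := by
    rw [hg]
    simp only [coef_add, coef_smul, coef_two_e_mul, hw1]
    ring
  have hww : |coef 2 (w ⋆ w)| ≤ R ^ 2 :=
    ((abs_coef_le _ _).trans (norm_mul_le_of_le hw hw)).trans_eq (sq R).symm
  rw [hcg]
  have i1 : |A * coef 3 w + A ^ 2 * coef 2 (w ⋆ w)| ≤ 2 * R ^ 2 * A ^ 2 := by
    refine (abs_add_le _ _).trans ?_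
    rw [abs_mul, abs_mul, abs_of_nonneg (sq_nonneg A), ← sq_abs A]
    have := mul_le_mul_of_nonneg_left hw3 hA0
    have := mul_le_mul_of_nonneg_left hww (sq_nonneg |A|)
    linarith
  have i2 : |A * coef 2 (y ⋆ (y ⋆ y))| ≤ R ^ 2 * A ^ 2 := by
    rw [abs_mul, ← sq_abs A]
    have := mul_le_mul_of_nonneg_left hcube hA0
    linarith
  refine (abs_add_le _ _).trans ?_
  rw [abs_mul]
  have i3 : |s| * |A * coef 3 w + A ^ 2 * coef 2 (w ⋆ w)| ≤ R * (2 * R ^ 2 * A ^ 2) := by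
    gcongr; linarith [abs_nonneg s]
  have i4 : R ^ 2 * A ^ 2 ≤ R ^ 3 * A ^ 2 := by
    gcongr
    · linarith
    · norm_num
  have : 0 ≤ R ^ 3 * A ^ 2 := by positivity
  linarith

/-- 3/4 is mode one of cos³, and -s²d₂/2 comes from cos ξ times the leading cos 2ξ part of `w`. The
terms of order A drop out by parity: cos²2ξ and cos²ξ cos 2ξ have no mode one. -/
lemma abs_ampl_sub_leading_le {s : ℝ} {d lam : ℕ → ℝ} (hd : IsInv d lam) {A : ℝ} {w : CosSeq}
    (hA : |A| * radius s ≤ 1) (hw : ‖w‖ ≤ radius s) (fw : step s hd A w = w) :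
    |ampl s A w - (3 / 4 - s ^ 2 * d 2 / 2)| ≤ 10 * radius s ^ 4 * A ^ 2 := by
  obtain ⟨g, hgn, hrep, hg2⟩ := exists_remainder hd hA hw fw
  set R := radius s with hR
  have hR1 : 125 ≤ R := radius_ge s
  have hsR : 25 * |s| ≤ R := by rw [hR, radius]; linarith
  have hA0 : 0 ≤ |A| := abs_nonneg A
  have hA1 := abs_le_one_of_radius hA
  have hRA : 0 ≤ R ^ 2 * |A| := by positivity
  set r := diag d (1 / 4) hd.le g with hr
  have hrn : ‖r‖ ≤ R ^ 2 * |A| := by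
    have := norm_diag_le hd g
    rw [← hr] at this
    linarith
  set b := -(s * d 2 / 2) with hb
  have hb1 : |b| ≤ |s| := by
    rw [hb, abs_neg, abs_div, abs_mul, abs_two]
    have := mul_le_mul_of_nonneg_left (hd.le 2) (abs_nonneg s)
    linarith [abs_nonneg s]
  have hw0n : ‖b • e 2‖ ≤ R := by
    have h1 := norm_smul_le_of_le hb1 (norm_e 2).le
    norm_num at h1
    linarith [abs_nonneg s]
  have hr2 : |coef 2 r| ≤ R ^ 3 * A ^ 2 := by
    rw [hr, coef_diag, abs_mul]
    have := mul_le_mul (hd.le 2) hg2 (abs_nonneg _) (by norm_num)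
    linarith
  have hw0 : coef 0 w = 0 := by rw [hrep]; simp [coef_e, hr, coef_diag, hd.zero]
  have hw2 : coef 2 w = b - coef 2 r := by rw [hrep]; simp [coef_e]
  have hsq : |coef 1 (w ⋆ w)| ≤ 2 * R ^ 3 * |A| := by
    have h1 : w ⋆ w = (b * b) • (e 2 ⋆ e 2) - r ⋆ (w + b • e 2) := by
      conv_lhs => rw [hrep]
      conv_rhs => rw [hrep]
      refine ext_toFun fun x => ?_
      simp; ring
    have h2 : coef 1 (w ⋆ w) = -coef 1 (r ⋆ (w + b • e 2)) := by
      rw [h1, e_two_sq]; simp [coef_e]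
    rw [h2, abs_neg]
    refine (abs_coef_le _ _).trans ((norm_mul_le_of_le hrn
      ((norm_add_le _ _).trans (add_le_add hw hw0n))).trans (le_of_eq ?_))
    ring
  have hcw : |coef 1 (e 1 ⋆ (e 1 ⋆ w))| ≤ 16 * R ^ 2 * |A| := by
    have h1 : e 1 ⋆ (e 1 ⋆ w) = b • (e 1 ⋆ (e 1 ⋆ e 2)) - e 1 ⋆ (e 1 ⋆ r) := by
      conv_lhs => rw [hrep]
      refine ext_toFun fun x => ?_
      simp; ring
    have h2 : coef 1 (e 1 ⋆ (e 1 ⋆ w)) = -coef 1 (e 1 ⋆ (e 1 ⋆ r)) := by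
      rw [h1, e_one_sq_mul_e_two]; simp [coef_e]
    rw [h2, abs_neg]
    refine (abs_coef_le _ _).trans ((norm_mul_le_of_le norm_e_one.le
      (norm_mul_le_of_le norm_e_one.le hrn)).trans (le_of_eq ?_))
    ring
  have hkey : ampl s A w - (3 / 4 - s ^ 2 * d 2 / 2) = -(s * coef 2 r) + s * A * coef 1 (w ⋆ w) +
      (3 * A) * coef 1 (e 1 ⋆ (e 1 ⋆ w)) +
      coef 1 ((3 * A ^ 2) • (e 1 ⋆ (w ⋆ w)) + A ^ 3 • (w ⋆ (w ⋆ w))) := by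
    have h1 : (e 1 + A • w) ⋆ ((e 1 + A • w) ⋆ (e 1 + A • w)) = e 1 ⋆ (e 1 ⋆ e 1) +
        (3 * A) • (e 1 ⋆ (e 1 ⋆ w)) +
        ((3 * A ^ 2) • (e 1 ⋆ (w ⋆ w)) + A ^ 3 • (w ⋆ (w ⋆ w))) := by
      refine ext_toFun fun x => ?_
      simp; ring
    have h2 : coef 1 (e 1 ⋆ (e 1 ⋆ e 1)) = 3 / 4 := by
      rw [e_one_cube]; simp [coef_e]
    rw [ampl, h1, coef_add, coef_add, h2, coef_smul (t := 3 * A), coef_one_e_mul w, hw0, hw2, hb]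
    ring
  have t1 : |s * coef 2 r| ≤ R ^ 4 * A ^ 2 := by
    rw [abs_mul]
    have := mul_le_mul (by linarith [abs_nonneg s] : |s| ≤ R) hr2 (abs_nonneg _) (by linarith)
    linarith
  have t2 : |s * A * coef 1 (w ⋆ w)| ≤ 2 * R ^ 4 * A ^ 2 := by
    rw [abs_mul, abs_mul, ← sq_abs A]
    have h1 : |s| * |A| ≤ R * |A| := by gcongr; linarith [abs_nonneg s]
    have := mul_le_mul h1 hsq (abs_nonneg _) (by positivity)
    linarith
  have t3 : |3 * A * coef 1 (e 1 ⋆ (e 1 ⋆ w))| ≤ 48 * R ^ 2 * A ^ 2 := by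
    rw [abs_mul, abs_mul, ← sq_abs A, abs_of_pos (by norm_num : (0 : ℝ) < 3)]
    have := mul_le_mul_of_nonneg_left hcw (by positivity : 0 ≤ 3 * |A|)
    linarith
  have t4 : |coef 1 ((3 * A ^ 2) • (e 1 ⋆ (w ⋆ w)) + A ^ 3 • (w ⋆ (w ⋆ w)))| ≤
      13 * R ^ 2 * A ^ 2 := by
    refine (abs_coef_le _ _).trans ((norm_add_le _ _).trans ?_)
    have hww := norm_mul_le_of_le hw hw
    have h1 := norm_smul_le_of_le (t := 3 * A ^ 2) (x := 3 * |A| ^ 2)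
      (by rw [abs_mul, abs_pow, abs_of_pos (by norm_num : (0 : ℝ) < 3)])
      (norm_mul_le_of_le norm_e_one.le hww)
    have h2 := norm_smul_le_of_le (t := A ^ 3) (x := |A| ^ 3) (by rw [abs_pow])
      (norm_mul_le_of_le hw hww)
    have h3 : |A| ^ 2 * R ^ 2 * (|A| * R) ≤ |A| ^ 2 * R ^ 2 * 1 := by gcongr
    rw [sq_abs] at h1 h3
    have h4 : |A| ^ 3 = A ^ 2 * |A| := by rw [pow_succ, sq_abs]
    rw [h4] at h2
    linarith
  rw [hkey]
  have hR4 : 61 * R ^ 2 * A ^ 2 ≤ R ^ 4 * A ^ 2 := by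
    have h61 : 61 ≤ R ^ 2 := by nlinarith
    have : 61 * R ^ 2 ≤ R ^ 4 := by
      rw [show R ^ 4 = R ^ 2 * R ^ 2 by ring]
      gcongr
    gcongr
  have h1 := abs_add_three (-(s * coef 2 r) + s * A * coef 1 (w ⋆ w))
    ((3 * A) * coef 1 (e 1 ⋆ (e 1 ⋆ w)))
    (coef 1 ((3 * A ^ 2) • (e 1 ⋆ (w ⋆ w)) + A ^ 3 • (w ⋆ (w ⋆ w))))
  have h2 := abs_add_le (-(s * coef 2 r)) (s * A * coef 1 (w ⋆ w))
  rw [abs_neg] at h2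
  have : 0 ≤ R ^ 4 * A ^ 2 := by positivity
  linarith

/-! ### Regularity -/

/-- Of the six powers, two are the weight of `CosSeq` and four come from the decay of `d`; 64 = 2⁴ ·
4. -/
lemma smooth_term_diag_le {d lam : ℕ → ℝ} (hd : IsInv d lam) (g : CosSeq) (n : ℕ) :
    (1 + n : ℝ) ^ 6 * |coef n (diag d (1 / 4) hd.le g)| ≤ 64 * |g n| := by
  rw [coef_diag, abs_mul, coef, abs_div, abs_of_pos (weight_pos n)]
  have h1 : (1 + n : ℝ) ^ 6 * (|d n| * (|g n| / (1 + n) ^ 2)) =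
      ((1 + n : ℝ) ^ 4 * |d n|) * |g n| := by
    have := weight_pos n
    field_simp
  rw [h1]
  refine mul_le_mul_of_nonneg_right ?_ (abs_nonneg _)
  by_cases hn : n = 0
  · subst hn; simp [hd.zero]
  have hn1 : (1 : ℝ) ≤ n := by exact_mod_cast Nat.one_le_iff_ne_zero.2 hn
  calc (1 + n : ℝ) ^ 4 * |d n| ≤ (2 * n) ^ 4 * |d n| := by gcongr; linarith
    _ = 16 * (n ^ 4 * |d n|) := by ring
    _ ≤ 64 := by linarith [hd.decay n]

lemma smooth_diag {d lam : ℕ → ℝ} (hd : IsInv d lam) (g : CosSeq) :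
    (diag d (1 / 4) hd.le g).Smooth :=
  Summable.of_nonneg_of_le (fun n => by positivity) (smooth_term_diag_le hd g)
    (g.summable_abs.mul_left 64)

lemma tsum_smooth_diag_le {d lam : ℕ → ℝ} (hd : IsInv d lam) (g : CosSeq) :
    ∑' n : ℕ, (1 + n : ℝ) ^ 6 * |coef n (diag d (1 / 4) hd.le g)| ≤ 64 * ‖g‖ := by
  rw [norm_eq, ← tsum_mul_left]
  exact Summable.tsum_le_tsum (smooth_term_diag_le hd g) (smooth_diag hd g)
    (g.summable_abs.mul_left 64)

lemma smooth_e (m : ℕ) : (e m).Smooth := by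
  refine summable_of_ne_finset_zero (s := {m}) fun n hn => ?_
  rw [Finset.mem_singleton] at hn
  simp [coef_e, hn]

lemma tsum_smooth_e (m : ℕ) : ∑' n : ℕ, (1 + n : ℝ) ^ 6 * |coef n (e m)| = (1 + m) ^ 6 := by
  rw [tsum_eq_single m]
  · simp [coef_e]
  · intro n hn; simp [coef_e, hn]

lemma Smooth.smul {a : CosSeq} (ha : a.Smooth) (t : ℝ) : (t • a).Smooth := by
  have : (fun n : ℕ => (1 + n : ℝ) ^ 6 * |coef n (t • a)|) =
      fun n : ℕ => |t| * ((1 + n : ℝ) ^ 6 * |coef n a|) := by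
    ext n; rw [coef_smul, abs_mul]; ring
  rw [Smooth, this]
  exact Summable.mul_left _ ha

lemma tsum_smooth_smul (a : CosSeq) (t : ℝ) :
    ∑' n : ℕ, (1 + n : ℝ) ^ 6 * |coef n (t • a)| =
      |t| * ∑' n : ℕ, (1 + n : ℝ) ^ 6 * |coef n a| := by
  rw [← tsum_mul_left]
  exact tsum_congr fun n => by rw [coef_smul, abs_mul]; ring

lemma smooth_term_add_le (a b : CosSeq) (n : ℕ) :
    (1 + n : ℝ) ^ 6 * |coef n (a + b)| ≤
      (1 + n : ℝ) ^ 6 * |coef n a| + (1 + n : ℝ) ^ 6 * |coef n b| := by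
  rw [coef_add, ← mul_add]
  exact mul_le_mul_of_nonneg_left (abs_add_le _ _) (by positivity)

lemma Smooth.add {a b : CosSeq} (ha : a.Smooth) (hb : b.Smooth) : (a + b).Smooth :=
  Summable.of_nonneg_of_le (fun n => by positivity) (smooth_term_add_le a b) (Summable.add ha hb)

lemma tsum_smooth_add_le {a b : CosSeq} (ha : a.Smooth) (hb : b.Smooth) :
    ∑' n : ℕ, (1 + n : ℝ) ^ 6 * |coef n (a + b)| ≤
      ∑' n : ℕ, (1 + n : ℝ) ^ 6 * |coef n a| + ∑' n : ℕ, (1 + n : ℝ) ^ 6 * |coef n b| := by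
  rw [← Summable.tsum_add ha hb]
  exact (ha.add hb).tsum_le_tsum (smooth_term_add_le a b) (Summable.add ha hb)

/-! ### Solutions of the coefficient equations -/

/-- The coefficient form of the profile equation. -/
def Solves (s : ℝ) (lam : ℕ → ℝ) (a : CosSeq) : Prop :=
  ∀ n, n ≠ 0 → lam n * coef n a + coef n (nonlin s 1 a) = 0

/-- The solution with amplitude `A` and noncritical part `A² w`. -/
def ansatz (A : ℝ) (w : CosSeq) : CosSeq := A • (e 1 + A • w)

lemma nonlin_ansatz (s A : ℝ) (w : CosSeq) :
    nonlin s 1 (ansatz A w) = A ^ 2 • nonlin s A (e 1 + A • w) := by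
  refine ext_toFun fun x => ?_
  simp [nonlin, ansatz]; ring

lemma coef_fixedPoint {s : ℝ} {d lam : ℕ → ℝ} (hd : IsInv d lam) {A : ℝ} {w : CosSeq}
    (fw : step s hd A w = w) (n : ℕ) :
    coef n w = -(d n * coef n (nonlin s A (e 1 + A • w))) := by
  conv_lhs => rw [← fw]
  rw [step, coef_neg, coef_diag]

lemma coef_one_ansatz {s : ℝ} {d lam : ℕ → ℝ} (hd : IsInv d lam) {A : ℝ} {w : CosSeq}
    (fw : step s hd A w = w) : coef 1 (ansatz A w) = A := by
  have h1 := coef_fixedPoint hd fw 1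
  rw [hd.one] at h1
  simp [ansatz, coef_e, h1]

lemma coef_zero_ansatz {s : ℝ} {d lam : ℕ → ℝ} (hd : IsInv d lam) {A : ℝ} {w : CosSeq}
    (fw : step s hd A w = w) : coef 0 (ansatz A w) = 0 := by
  have h1 := coef_fixedPoint hd fw 0
  rw [hd.zero] at h1
  simp [ansatz, coef_e, h1]

/-- The ansatz solves the equation as soon as the bifurcation equation holds. -/
lemma solves_ansatz_iff {s : ℝ} {d lam : ℕ → ℝ} (hd : IsInv d lam) {A : ℝ} {w : CosSeq}
    (fw : step s hd A w = w) :
    Solves s lam (ansatz A w) ↔ lam 1 * A + A ^ 3 * ampl s A w = 0 := by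
  have h1 : coef 1 (nonlin s 1 (ansatz A w)) = A ^ 3 * ampl s A w := coef_one_nonlin s A w
  constructor
  · intro h
    have := h 1 one_ne_zero
    rwa [coef_one_ansatz hd fw, h1] at this
  · intro h n hn
    by_cases hn1 : n = 1
    · subst hn1; rwa [coef_one_ansatz hd fw, h1]
    · have hn2 : 2 ≤ n := by omega
      have h2 := coef_fixedPoint hd fw n
      have h3 := hd.inv n hn2
      rw [nonlin_ansatz, coef_smul, ansatz, coef_smul, coef_add, coef_smul, coef_e, if_neg hn1, h2]
      linear_combination (-A ^ 2 * coef n (nonlin s A (e 1 + A • w))) * h3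

/-- Small solutions are of the form of the ansatz. -/
lemma exists_ansatz {s : ℝ} {d lam : ℕ → ℝ} (hd : IsInv d lam) {a : CosSeq}
    (ha : ‖a‖ * radius s ≤ 1) (h0 : coef 0 a = 0) (hs : Solves s lam a) :
    ∃ A w, |A| * radius s ≤ 1 ∧ ‖w‖ ≤ radius s ∧ step s hd A w = w ∧ a = ansatz A w := by
  have hR := radius_ge s
  set A := coef 1 a with hA
  set z := a - A • e 1 with hz
  have hAa : |A| ≤ ‖a‖ := abs_coef_le 1 a
  have hAR : |A| * radius s ≤ 1 := le_trans (by gcongr) ha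
  -- Modes zero and one of `z` vanish, as `d` does there; the other equations are divided by the
  -- multiplier.
  have hz1 : z = -diag d (1 / 4) hd.le (nonlin s 1 a) := by
    refine ext_coef fun n => ?_
    rw [hz, coef_neg, coef_diag, coef_sub, coef_smul, coef_e]
    by_cases hn0 : n = 0
    · subst hn0; simp [h0, hd.zero]
    by_cases hn1 : n = 1
    · subst hn1; simp [hd.one, hA]
    · rw [if_neg hn1]
      linear_combination d n * hs n hn0 - coef n a * hd.inv n (by omega)
  have ha1 : ‖a‖ ≤ 1 := by nlinarith [norm_nonneg a]
  have hzn : ‖z‖ ≤ 1 / 4 * ((|s| + 1) * ‖a‖ ^ 2) := by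
    rw [hz1, norm_neg]
    refine (norm_diag_le hd _).trans (mul_le_mul_of_nonneg_left ?_ (by norm_num))
    rw [nonlin]
    have h1 := norm_smul_le_of_le (le_refl |s|) (norm_mul_le a a)
    have h2 := norm_smul_le_of_le (abs_one (α := ℝ)).le
      (norm_mul_le_of_le (le_refl ‖a‖) (norm_mul_le a a))
    have h3 : ‖a‖ * ‖a‖ ^ 2 ≤ 1 * ‖a‖ ^ 2 := by gcongr
    refine (norm_add_le _ _).trans ?_
    linarith
  have haz : ‖a‖ ≤ 4 * |A| + ‖z‖ := by
    have h1 : a = A • e 1 + z := by rw [hz]; abel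
    have h2 := norm_smul_le_of_le (le_refl |A|) norm_e_one.le
    have h3 := norm_add_le (A • e 1) z
    rw [← h1] at h3
    linarith
  have hs25 : 25 * (|s| + 1) ≤ radius s := by rw [radius]; linarith
  have hsa : 25 * (|s| + 1) * ‖a‖ ≤ 1 := by
    refine le_trans ?_ ha
    rw [mul_comm ‖a‖]
    gcongr
  -- `z` is quadratic in `a`, hence negligible against it. So `a` is comparable with its first mode,
  -- and `z` is O(A²).
  have hz2 : 100 * ‖z‖ ≤ ‖a‖ := by
    have : 25 * (|s| + 1) * ‖a‖ * ‖a‖ ≤ 1 * ‖a‖ := by gcongr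
    linarith
  have ha5 : ‖a‖ ≤ 5 * |A| := by linarith [norm_nonneg a]
  have hz3 : ‖z‖ ≤ radius s * A ^ 2 := by
    have h1 : ‖a‖ ^ 2 ≤ (5 * |A|) ^ 2 := by gcongr
    rw [mul_pow, sq_abs] at h1
    have h2 : (|s| + 1) * ‖a‖ ^ 2 ≤ (|s| + 1) * (5 ^ 2 * A ^ 2) := by gcongr
    have h3 : 25 * (|s| + 1) * A ^ 2 ≤ radius s * A ^ 2 := by gcongr
    have h4 : 0 ≤ radius s * A ^ 2 := by positivity
    linarith
  -- Rescaling `z` by A² needs A ≠ 0. For A = 0 the bound ‖a‖ ≤ 5|A| gives a = 0, and any fixed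
  -- point serves as `w`.
  by_cases hA0 : A = 0
  · obtain ⟨w, hw, fw⟩ := exists_fixedPoint s hd hAR
    refine ⟨A, w, hAR, hw, fw, ?_⟩
    rw [hA0, abs_zero, mul_zero] at ha5
    have : a = 0 := norm_le_zero_iff.1 ha5
    rw [hA0, ansatz, zero_smul, this]
  · have haw : a = ansatz A ((A ^ 2)⁻¹ • z) := by
      rw [ansatz, smul_add, smul_smul, smul_smul, hz]
      have : A * A * (A ^ 2)⁻¹ = 1 := by field_simp
      rw [this, one_smul]; abel
    refine ⟨A, (A ^ 2)⁻¹ • z, hAR, ?_, ?_, haw⟩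
    · rw [norm_smul, Real.norm_of_nonneg (by positivity), inv_mul_le_iff₀ (by positivity)]
      linarith
    · refine ext_coef fun n => ?_
      have h1 := nonlin_ansatz s A ((A ^ 2)⁻¹ • z)
      rw [← haw] at h1
      conv_rhs => rw [hz1, h1]
      rw [step, coef_neg, coef_diag, coef_smul, coef_neg, coef_diag, coef_smul]
      field_simp

/-! ### The bifurcation equation -/

/-- Intermediate value theorem for A²h(A) on [0, A₁], which runs from 0 to at least A₁²c. The
Lipschitz bound makes h continuous along any choice of fixed points. -/
lemma exists_amplitude (s : ℝ) {d lam : ℕ → ℝ} (hd : IsInv d lam) {A₁ c μ : ℝ} (hA₁ : 0 ≤ A₁)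
    (hR : A₁ * radius s ≤ 1)
    (hc : ∀ A w, |A| ≤ A₁ → ‖w‖ ≤ radius s → step s hd A w = w → c ≤ ampl s A w)
    (hμ0 : 0 ≤ μ) (hμ : μ ≤ A₁ ^ 2 * c) :
    ∃ A w, 0 ≤ A ∧ A ≤ A₁ ∧ ‖w‖ ≤ radius s ∧ step s hd A w = w ∧ A ^ 2 * ampl s A w = μ := by
  have hRpos := radius_ge s
  have hAR : ∀ A ∈ Set.Icc 0 A₁, |A| * radius s ≤ 1 := fun A hA => by
    rw [abs_of_nonneg hA.1]
    exact le_trans (mul_le_mul_of_nonneg_right hA.2 (by linarith)) hR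
  have hex : ∀ A, ∃ w, A ∈ Set.Icc 0 A₁ → ‖w‖ ≤ radius s ∧ step s hd A w = w := fun A => by
    by_cases hA : A ∈ Set.Icc 0 A₁
    · obtain ⟨w, hw⟩ := exists_fixedPoint s hd (hAR A hA)
      exact ⟨w, fun _ => hw⟩
    · exact ⟨0, fun h => absurd h hA⟩
  choose W hW using hex
  have hcont : ContinuousOn (fun A => ampl s A (W A)) (Set.Icc 0 A₁) := by
    refine LipschitzOnWith.continuousOn (K := (10 * radius s ^ 3).toNNReal)
      (LipschitzOnWith.of_dist_le_mul fun A hA B hB => ?_)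
    rw [Real.coe_toNNReal _ (by positivity), Real.dist_eq, Real.dist_eq]
    exact abs_ampl_sub_le hd (hAR A hA) (hAR B hB) (hW A hA).1 (hW B hB).1 (hW A hA).2 (hW B hB).2
  have hA₁mem : A₁ ∈ Set.Icc 0 A₁ := ⟨hA₁, le_rfl⟩
  have hivt := intermediate_value_Icc hA₁ ((continuousOn_id.pow 2).mul hcont)
  obtain ⟨A, hA, hAμ⟩ := hivt (a := μ) ⟨by simpa using hμ0, hμ.trans
    (mul_le_mul_of_nonneg_left (hc A₁ (W A₁) (abs_of_nonneg hA₁).le (hW A₁ hA₁mem).1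
      (hW A₁ hA₁mem).2) (sq_nonneg _))⟩
  exact ⟨A, W A, hA.1, hA.2, (hW A hA).1, (hW A hA).2, hAμ⟩

/-- (A - B)(A + B)h(A) = -B²(h(A) - h(B)). The left side is at least |A - B|(A + B)c in size; the
Lipschitz bound makes the right side smaller than |A - B|Bc unless A = B. -/
lemma amplitude_unique {s : ℝ} {d lam : ℕ → ℝ} (hd : IsInv d lam) {A₁ c A B : ℝ} {w z : CosSeq}
    (hR : A₁ * radius s ≤ 1) (hc : 10 * radius s ^ 3 * A₁ < c) (hA0 : 0 < A) (hB0 : 0 < B)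
    (hA : A ≤ A₁) (hB : B ≤ A₁) (hw : ‖w‖ ≤ radius s) (hz : ‖z‖ ≤ radius s)
    (fw : step s hd A w = w) (fz : step s hd B z = z) (hcA : c ≤ ampl s A w)
    (heq : A ^ 2 * ampl s A w = B ^ 2 * ampl s B z) : A = B := by
  have hR0 : 0 ≤ radius s := by linarith [radius_ge s]
  have hA₁ : 0 ≤ A₁ := hA0.le.trans hA
  have hAR : |A| * radius s ≤ 1 := by
    rw [abs_of_pos hA0]; exact le_trans (by gcongr) hR
  have hBR : |B| * radius s ≤ 1 := by
    rw [abs_of_pos hB0]; exact le_trans (by gcongr) hR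
  have hlip := abs_ampl_sub_le hd hAR hBR hw hz fw fz
  have h1 : (A - B) * ((A + B) * ampl s A w) = -(B ^ 2 * (ampl s A w - ampl s B z)) := by
    linear_combination heq
  have h2 : |A - B| * ((A + B) * c) ≤ |A - B| * (B * (10 * radius s ^ 3 * A₁)) := by
    have hcpos : 0 ≤ c := le_trans (by positivity) hc.le
    calc |A - B| * ((A + B) * c) ≤ |A - B| * ((A + B) * ampl s A w) := by gcongr
      _ = |(A - B) * ((A + B) * ampl s A w)| := by
        rw [abs_mul, abs_of_nonneg (mul_nonneg (by linarith) (hcpos.trans hcA))]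
      _ = B ^ 2 * |ampl s A w - ampl s B z| := by
        rw [h1, abs_neg, abs_mul, abs_of_nonneg (sq_nonneg B)]
      _ ≤ B ^ 2 * (10 * radius s ^ 3 * |A - B|) := by gcongr
      _ = |A - B| * (B * (10 * radius s ^ 3 * B)) := by ring
      _ ≤ _ := by gcongr
  by_contra hne
  have hpos : 0 < |A - B| := abs_pos.2 (sub_ne_zero.2 hne)
  have h3 := le_of_mul_le_mul_left h2 hpos
  have h4 : B * (10 * radius s ^ 3 * A₁) < B * c := mul_lt_mul_of_pos_left hc hB0
  have h5 : 0 < A * c := mul_pos hA0 (lt_of_le_of_lt (by positivity) hc)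
  linarith

/-! ### The multiplier of the profile equation -/

/-- The multiplier of `(1 + k² ∂²)² - ε²`. -/
def symbol (ε k : ℝ) (n : ℕ) : ℝ := (1 - k ^ 2 * n ^ 2) ^ 2 - ε ^ 2

/-- The inverse of the multiplier on the noncritical modes. -/
def symbolInv (ε k : ℝ) (n : ℕ) : ℝ := if n < 2 then 0 else (symbol ε k n)⁻¹

/-- k²n² - 1 ≥ 7n²/8 - n²/4 = 5n²/8, and the surplus (25/64 - 1/4)n⁴ exceeds ε². -/
lemma symbol_ge {ε k : ℝ} (hk : |k ^ 2 - 1| ≤ 1 / 8) (hε : ε ^ 2 ≤ 1) {n : ℕ} (hn : 2 ≤ n) :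
    (n : ℝ) ^ 4 / 4 ≤ symbol ε k n := by
  have hn2 : (2 : ℝ) ≤ n := by exact_mod_cast hn
  have hn4 : (4 : ℝ) ≤ (n : ℝ) ^ 2 := by nlinarith
  have hk1 : 7 / 8 ≤ k ^ 2 := by linarith [(abs_le.1 hk).1]
  have h1 : 5 / 8 * (n : ℝ) ^ 2 ≤ k ^ 2 * n ^ 2 - 1 := by
    have : 7 / 8 * (n : ℝ) ^ 2 ≤ k ^ 2 * n ^ 2 := by gcongr
    linarith
  have h2 : (5 / 8 * (n : ℝ) ^ 2) ^ 2 ≤ (k ^ 2 * n ^ 2 - 1) ^ 2 := by gcongr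
  have h3 : (4 : ℝ) ^ 2 ≤ ((n : ℝ) ^ 2) ^ 2 := by gcongr
  rw [symbol]
  nlinarith

lemma isInv_symbolInv {ε k : ℝ} (hk : |k ^ 2 - 1| ≤ 1 / 8) (hε : ε ^ 2 ≤ 1) :
    IsInv (symbolInv ε k) (symbol ε k) := by
  have hdec : ∀ n : ℕ, (n : ℝ) ^ 4 * |symbolInv ε k n| ≤ 4 := by
    intro n
    rw [symbolInv]
    split_ifs with h
    · simp
    · have hn : 2 ≤ n := by omega
      have h1 := symbol_ge hk hε hn
      have hn2 : (2 : ℝ) ≤ n := by exact_mod_cast hn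
      have h4 : 0 < (n : ℝ) ^ 4 := by positivity
      have h5 : 0 < symbol ε k n := by linarith
      rw [abs_inv, abs_of_pos h5, ← div_eq_mul_inv, div_le_iff₀ h5]
      linarith
  refine ⟨by simp [symbolInv], by simp [symbolInv], fun n => ?_, hdec, fun n hn => ?_⟩
  · by_cases h : n < 2
    · simp [symbolInv, h]
    · have hn2 : (2 : ℝ) ≤ n := by exact_mod_cast (by omega : 2 ≤ n)
      have h4 : (2 : ℝ) ^ 4 ≤ (n : ℝ) ^ 4 := by gcongr
      have := hdec n
      have h0 := abs_nonneg (symbolInv ε k n)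
      nlinarith
  · have h1 := symbol_ge hk hε hn
    have hn2 : (2 : ℝ) ≤ n := by exact_mod_cast hn
    have h4 : 0 < (n : ℝ) ^ 4 := by positivity
    rw [symbolInv, if_neg (by omega)]
    exact inv_mul_cancel₀ (by linarith)

lemma cosCoeff_nonlin {s : ℝ} (a : CosSeq) {n : ℕ} (hn : n ≠ 0) :
    cosCoeff n (fun ξ => s * toFun a ξ ^ 2 + toFun a ξ ^ 3) = coef n (nonlin s 1 a) := by
  rw [← cosCoeff_toFun _ hn]
  congr 1
  ext ξ
  simp [nonlin]; ring

lemma solves_of_isEvenProfile {ε k s : ℝ} (hk : k ≠ 0) {a : CosSeq}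
    (h : IsEvenProfile ε k s (toFun a)) : Solves s (symbol ε k) a := by
  intro n hn
  have := (exists_solvesProfile_iff hk h.1 h.2.1).1 h.2.2.2 n hn
  rwa [cosCoeff_toFun a hn, cosCoeff_nonlin a hn] at this

lemma isEvenProfile_of_solves {ε k s : ℝ} (hk : k ≠ 0) {a : CosSeq} (ha : a.Smooth)
    (h0 : coef 0 a = 0) (h : Solves s (symbol ε k) a) : IsEvenProfile ε k s (toFun a) := by
  refine ⟨memH6per_toFun ha, a.toFun_even, by rw [integral_toFun, h0, mul_zero],
    (exists_solvesProfile_iff hk (memH6per_toFun ha) a.toFun_even).2 fun n hn => ?_⟩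
  rw [cosCoeff_toFun a hn, cosCoeff_nonlin a hn]
  exact h n hn

/-- The multiplier is (3 + 8κ)² - ε² = 9 + 48κ + O(ε²), where κ stands for ωε. It is at least 4,
which turns the error 32ε² into 8ε². -/
lemma symbolInv_two_expansion {ε κ k : ℝ} (hk : k ^ 2 = 1 + 2 * κ) (hε : 0 < ε) (hε1 : ε ≤ 1 / 8)
    (hκ : |κ| ≤ ε / 2) : |symbolInv ε k 2 - (1 / 9 - 16 / 27 * κ)| ≤ 8 * ε ^ 2 := by
  have hk8 : |k ^ 2 - 1| ≤ 1 / 8 := by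
    rw [hk, add_sub_cancel_left, abs_mul, abs_two]; linarith
  have h4 := symbol_ge hk8 (by nlinarith : ε ^ 2 ≤ 1) (le_refl 2)
  have hd : symbolInv ε k 2 = (symbol ε k 2)⁻¹ := by simp [symbolInv]
  have hL : symbol ε k 2 = 9 + 48 * κ + 64 * κ ^ 2 - ε ^ 2 := by
    rw [symbol, hk]; push_cast; ring
  rw [hd]
  set L := symbol ε k 2
  norm_num at h4
  have hL0 : 0 < L := by linarith
  have h1 : L⁻¹ - (1 / 9 - 16 / 27 * κ) = (1 - L * (1 / 9 - 16 / 27 * κ)) / L := by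
    field_simp
  rw [h1, abs_div, abs_of_pos hL0, div_le_iff₀ hL0]
  have h2 : 1 - L * (1 / 9 - 16 / 27 * κ) =
      κ ^ 2 * (64 / 3) + κ * κ ^ 2 * (1024 / 27) + ε ^ 2 * (1 / 9) - κ * ε ^ 2 * (16 / 27) := by
    rw [hL]; ring
  have hκ2 : κ ^ 2 ≤ ε ^ 2 / 4 := by
    rw [← sq_abs]; nlinarith [abs_nonneg κ]
  have hκ1 := abs_le.1 (hκ.trans (by linarith : ε / 2 ≤ 1 / 16))
  have h3 : |1 - L * (1 / 9 - 16 / 27 * κ)| ≤ 32 * ε ^ 2 := by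
    rw [h2, abs_le]
    constructor <;> nlinarith [sq_nonneg κ, sq_nonneg ε]
  nlinarith [sq_nonneg ε]

/-! ### Asymptotics of the amplitude -/

/-- T = (6 - 32κs²/D)/√D satisfies hT² = 1 + O(ε²), and (A - mεT)(A + mεT)h = ε²m²(1 - hT²).
Dividing by (A + mεT)h, which is at least a multiple of mε, keeps the bound uniform as m = √(1 -
4ω²) tends to 0. -/
lemma abs_amplitude_sub_le {D s ε κ m A h K : ℝ} (hD : 0 < D) (hε : 0 < ε) (hκ : |κ| ≤ ε / 2)
    (hx : 32 * |κ| * s ^ 2 ≤ 3 * D) (hm : 0 ≤ m) (hm1 : m ≤ 1) (hA : 0 ≤ A) (hh : D / 72 ≤ h)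
    (hK : |h - (D / 36 + 8 / 27 * s ^ 2 * κ)| ≤ K * ε ^ 2) (heq : A ^ 2 * h = ε ^ 2 * m ^ 2) :
    |A - m * ε * ((6 - 32 * κ * s ^ 2 / D) / √D)| ≤
      24 * (50 * (s ^ 2 / D) ^ 2 + 81 * K / D) / √D * ε ^ 3 := by
  have hq := Real.sqrt_pos.2 hD
  have hq2 := Real.sq_sqrt hD.le
  set q := √D with hqdef
  set x := κ * (s ^ 2 / D) with hxdef
  have hxa : |x| = |κ| * (s ^ 2 / D) := by
    rw [hxdef, abs_mul, abs_of_nonneg (by positivity : 0 ≤ s ^ 2 / D)]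
  have hx1 : |x| ≤ 3 / 32 := by
    rw [hxa, ← mul_div_assoc, div_le_iff₀ hD]; linarith
  have hx2 : x ^ 2 ≤ ε ^ 2 / 4 * (s ^ 2 / D) ^ 2 := by
    have h1 : |x| ≤ ε / 2 * (s ^ 2 / D) := by rw [hxa]; gcongr
    rw [← sq_abs]
    calc |x| ^ 2 ≤ (ε / 2 * (s ^ 2 / D)) ^ 2 := by gcongr
      _ = _ := by ring
  obtain ⟨hxl, hxu⟩ := abs_le.1 hx1
  have hTx : (6 - 32 * κ * s ^ 2 / D) / q = (6 - 32 * x) / q := by rw [hxdef]; ring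
  rw [hTx]
  set T := (6 - 32 * x) / q with hT
  have hT3 : 3 / q ≤ T := by rw [hT]; gcongr; linarith
  set K' := 50 * (s ^ 2 / D) ^ 2 + 81 * K / D with hK'
  have hρ : |1 - h * T ^ 2| ≤ K' * ε ^ 2 := by
    set ρ := h - (D / 36 + 8 / 27 * s ^ 2 * κ) with hρdef
    have h1 : 1 - h * T ^ 2 = x ^ 2 * (768 / 9 - 8192 / 27 * x) - ρ * ((6 - 32 * x) ^ 2 / D) := by
      have hh' : h = D * (1 / 36 + 8 / 27 * x) + ρ := by
        rw [hρdef, hxdef]; field_simp; ring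
      rw [hT, div_pow, hq2, hh']
      field_simp
      ring
    have h2 : |x ^ 2 * (768 / 9 - 8192 / 27 * x)| ≤ x ^ 2 * 200 := by
      rw [abs_mul, abs_of_nonneg (sq_nonneg x)]
      gcongr
      rw [abs_le]; constructor <;> linarith
    have h3 : |ρ * ((6 - 32 * x) ^ 2 / D)| ≤ K * ε ^ 2 * (81 / D) := by
      rw [abs_mul, abs_of_nonneg (by positivity : 0 ≤ (6 - 32 * x) ^ 2 / D)]
      have : (6 - 32 * x) ^ 2 ≤ 81 := by nlinarith
      have h0 : 0 ≤ K * ε ^ 2 := (abs_nonneg _).trans hK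
      gcongr
    rw [h1]
    refine (abs_sub _ _).trans ?_
    calc _ ≤ x ^ 2 * 200 + K * ε ^ 2 * (81 / D) := add_le_add h2 h3
      _ ≤ ε ^ 2 / 4 * (s ^ 2 / D) ^ 2 * 200 + K * ε ^ 2 * (81 / D) := by gcongr
      _ = K' * ε ^ 2 := by rw [hK']; ring
  have hK'0 : 0 ≤ K' * ε ^ 2 := (abs_nonneg _).trans hρ
  have hh0 : 0 < h := lt_of_lt_of_le (by positivity) hh
  -- The factor mε is cancelled below, so m = 0 is treated apart; there A = 0.
  rcases hm.eq_or_lt with rfl | hmpos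
  · have hA0 : A = 0 := by
      have : A ^ 2 * h = 0 := by rw [heq]; ring
      have := (mul_eq_zero.1 this).resolve_right hh0.ne'
      exact pow_eq_zero_iff two_ne_zero |>.1 this
    rw [hA0]
    have : 24 * K' / q * ε ^ 3 = 24 / q * ε * (K' * ε ^ 2) := by ring
    rw [this]
    simpa using by positivity
  · have hTpos : 0 < T := lt_of_lt_of_le (by positivity) hT3
    set Δ := |A - m * ε * T| with hΔ
    have h1 : (A - m * ε * T) * ((A + m * ε * T) * h) = ε ^ 2 * m ^ 2 * (1 - h * T ^ 2) := by
      linear_combination heq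
    have h2 : Δ * (m * ε * (3 / q) * (D / 72)) ≤ ε ^ 2 * m ^ 2 * (K' * ε ^ 2) := by
      calc Δ * (m * ε * (3 / q) * (D / 72)) ≤ Δ * ((A + m * ε * T) * h) := by
            gcongr
            have : m * ε * (3 / q) ≤ m * ε * T := by gcongr
            linarith
        _ = |(A - m * ε * T) * ((A + m * ε * T) * h)| := by
            rw [abs_mul, abs_of_nonneg (by positivity : 0 ≤ (A + m * ε * T) * h)]
        _ = ε ^ 2 * m ^ 2 * |1 - h * T ^ 2| := by
            rw [h1, abs_mul, abs_of_nonneg (by positivity)]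
        _ ≤ _ := by gcongr
    have h3 : m * ε * (3 / q) * (D / 72) = m * ε * (q / 24) := by
      rw [← hq2]; field_simp; norm_num
    rw [h3] at h2
    have h4 : Δ * (m * ε * (q / 24)) ≤ (m * (24 * K' / q * ε ^ 3)) * (m * ε * (q / 24)) := by
      refine h2.trans (le_of_eq ?_)
      field_simp
    have h5 := le_of_mul_le_mul_right h4 (by positivity)
    refine h5.trans (mul_le_of_le_one_left ?_ hm1)
    have : 24 * K' / q * ε ^ 3 = 24 / q * ε * (K' * ε ^ 2) := by ring
    rw [this]
    positivity

/-- A² = ε²m²/h already carries ε², so first-order knowledge of h and d suffices. -/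
lemma abs_second_mode_sub_le {D s ε m A h d K₁ K₂ : ℝ} (hD : 0 < D) (hε : 0 < ε)
    (hm : 0 ≤ m) (hm1 : m ≤ 1) (hh : D / 72 ≤ h) (h1 : |h - D / 36| ≤ K₁ * ε)
    (h2 : |d - 1 / 9| ≤ K₂ * ε) (heq : A ^ 2 * h = ε ^ 2 * m ^ 2) :
    |A ^ 2 * (-(s * d / 2)) + 2 * s * m ^ 2 / D * ε ^ 2| ≤
      36 * |s| * (4 * K₁ + D * K₂) / D ^ 2 * ε ^ 3 := by
  have hh0 : 0 < h := lt_of_lt_of_le (by positivity) hh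
  have hA2 : A ^ 2 = ε ^ 2 * m ^ 2 / h := by rw [eq_div_iff hh0.ne']; exact heq
  have h3 : A ^ 2 * (-(s * d / 2)) + 2 * s * m ^ 2 / D * ε ^ 2 =
      ε ^ 2 * m ^ 2 * s * ((4 * (h - D / 36) - D * (d - 1 / 9)) / (2 * D * h)) := by
    rw [hA2]; field_simp; ring
  have hm2 : m ^ 2 ≤ 1 := pow_le_one₀ hm hm1
  have h4 : |4 * (h - D / 36) - D * (d - 1 / 9)| ≤ (4 * K₁ + D * K₂) * ε := by
    refine (abs_sub _ _).trans ?_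
    rw [abs_mul, abs_mul, abs_of_pos hD, abs_of_pos (by norm_num : (0 : ℝ) < 4)]
    have := mul_le_mul_of_nonneg_left h2 hD.le
    linarith
  have h40 := (abs_nonneg _).trans h4
  have h5 : |(4 * (h - D / 36) - D * (d - 1 / 9)) / (2 * D * h)| ≤
      (4 * K₁ + D * K₂) * ε / (2 * D * (D / 72)) := by
    rw [abs_div, abs_of_pos (by positivity : 0 < 2 * D * h)]
    gcongr
  rw [h3, abs_mul, abs_mul, abs_of_nonneg (by positivity : 0 ≤ ε ^ 2 * m ^ 2)]
  calc ε ^ 2 * m ^ 2 * |s| * |(4 * (h - D / 36) - D * (d - 1 / 9)) / (2 * D * h)|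
      ≤ ε ^ 2 * 1 * |s| * ((4 * K₁ + D * K₂) * ε / (2 * D * (D / 72))) := by gcongr
    _ = _ := by field_simp; ring

end CosSeq

lemma expansion_eq {s ω ε : ℝ} (hs : 0 < 27 - 2 * s ^ 2) (hω : 0 ≤ 1 - 4 * ω ^ 2) (ξ : ℝ) :
    expansion ε ω s ξ =
      √(1 - 4 * ω ^ 2) * ε * ((6 - 32 * (ω * ε) * s ^ 2 / (27 - 2 * s ^ 2)) / √(27 - 2 * s ^ 2)) *
        Real.cos ξ -
      2 * s * √(1 - 4 * ω ^ 2) ^ 2 / (27 - 2 * s ^ 2) * ε ^ 2 * Real.cos (2 * ξ) := by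
  have hq := Real.sqrt_pos.2 hs
  have h3 : √((27 - 2 * s ^ 2) ^ 3) = (27 - 2 * s ^ 2) * √(27 - 2 * s ^ 2) := by
    rw [show (27 - 2 * s ^ 2) ^ 3 = (27 - 2 * s ^ 2) ^ 2 * (27 - 2 * s ^ 2) by ring,
      Real.sqrt_mul (sq_nonneg _), Real.sqrt_sq hs.le]
  rw [expansion, Real.sqrt_div hω, Real.sqrt_div hω, h3, Real.sq_sqrt hω]
  field_simp
  ring

namespace CosSeq

/-! ### Assembly -/

/-- Splitting of the solution into its first two modes and a remainder of third order. -/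
lemma exists_ansatz_split {s : ℝ} {d lam : ℕ → ℝ} (hd : IsInv d lam) {A : ℝ} {w : CosSeq}
    (hA : |A| * radius s ≤ 1) (hw : ‖w‖ ≤ radius s) (fw : step s hd A w = w) :
    ∃ r : CosSeq, r.Smooth ∧
      ∑' n : ℕ, (1 + n : ℝ) ^ 6 * |coef n r| ≤ 128 * radius s ^ 2 * |A| ^ 3 ∧
      ansatz A w = A • e 1 + (A ^ 2 * (-(s * d 2 / 2))) • e 2 + r := by
  obtain ⟨g, hg, hrep, -⟩ := exists_remainder hd hA hw fw
  refine ⟨(-A ^ 2) • diag d (1 / 4) hd.le g, (smooth_diag hd g).smul _, ?_, ?_⟩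
  · rw [tsum_smooth_smul, abs_neg, abs_pow]
    have h := (tsum_smooth_diag_le hd g).trans (mul_le_mul_of_nonneg_left hg (by norm_num))
    calc _ ≤ |A| ^ 2 * (64 * (2 * radius s ^ 2 * |A|)) := by gcongr
      _ = _ := by ring
  · conv_lhs => rw [hrep]
    rw [ansatz]
    module

lemma smooth_three {r : CosSeq} (hr : r.Smooth) (α β : ℝ) :
    (α • e 1 + β • e 2 + r).Smooth :=
  (((smooth_e 1).smul α).add ((smooth_e 2).smul β)).add hr

lemma h6norm_three_le {r : CosSeq} (hr : r.Smooth) (α β : ℝ) :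
    h6norm (toFun (α • e 1 + β • e 2 + r)) ≤ √(14 * Real.pi) *
      (64 * |α| + 729 * |β| + ∑' n : ℕ, (1 + n : ℝ) ^ 6 * |coef n r|) := by
  refine (h6norm_toFun_le (smooth_three hr α β)).trans ?_
  gcongr
  refine (tsum_smooth_add_le (((smooth_e 1).smul α).add ((smooth_e 2).smul β)) hr).trans ?_
  gcongr
  refine (tsum_smooth_add_le ((smooth_e 1).smul α) ((smooth_e 2).smul β)).trans (le_of_eq ?_)
  rw [tsum_smooth_smul, tsum_smooth_smul, tsum_smooth_e, tsum_smooth_e]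
  norm_num
  ring

/-- u(0) = A(1 + A w(0)) with |A w(0)| < 1, so the sign condition at 0 selects the sign of the
amplitude. -/
lemma toFun_ansatz_zero_sign {s A : ℝ} {w : CosSeq} (hA : |A| * radius s < 1)
    (hw : ‖w‖ ≤ radius s) : (0 < A → 0 < toFun (ansatz A w) 0) ∧
      (A < 0 → toFun (ansatz A w) 0 < 0) := by
  have h1 : toFun (ansatz A w) 0 = A * (1 + A * toFun w 0) := by
    simp [ansatz]; ring
  have h2 : |A * toFun w 0| < 1 := by
    rw [abs_mul]
    refine lt_of_le_of_lt ?_ hA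
    gcongr
    exact (abs_toFun_le w 0).trans hw
  have h3 : 0 < 1 + A * toFun w 0 := by linarith [(abs_lt.1 h2).1]
  rw [h1]
  exact ⟨fun h => mul_pos h h3, fun h => mul_neg_of_neg_of_pos h h3⟩

/-- A₁ = D/(1000R³), with R the radius, meets all requirements: the contraction, a small error in
`ampl`, and a Lipschitz constant small enough for uniqueness. -/
lemma exists_amplitude_bound (s : ℝ) {D : ℝ} (hD0 : 0 < D) (hD27 : D ≤ 27) :
    ∃ A₁ > 0, A₁ ≤ 1 / 100 ∧ A₁ * radius s < 1 ∧ 10 * radius s ^ 4 * A₁ ^ 2 ≤ D / 288 ∧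
      10 * radius s ^ 3 * A₁ < D / 72 := by
  have hR1 := radius_ge s
  set R := radius s
  have hR0 : 0 < R := by linarith
  have h3 : D / (1000 * R ^ 3) * R ^ 3 = D / 1000 := by field_simp
  have hA : 0 < D / (1000 * R ^ 3) := by positivity
  set A₁ := D / (1000 * R ^ 3)
  have h2 : A₁ * R ≤ 1 / 4 := by
    have h1 : A₁ * R * R ^ 2 ≤ 1 / 4 * R ^ 2 := by nlinarith
    exact le_of_mul_le_mul_right h1 (by positivity)
  refine ⟨A₁, hA, ?_, by linarith, ?_, by linarith⟩
  · have : A₁ * 125 ≤ A₁ * R := by gcongr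
    linarith
  · have h1 : 10 * R ^ 4 * A₁ ^ 2 = 10 * (A₁ * R ^ 3) * (A₁ * R) := by ring
    rw [h1, h3]
    nlinarith

lemma abs_symbolInv_two_sub_le {ε κ k : ℝ} (hk : k ^ 2 = 1 + 2 * κ) (hε : 0 < ε)
    (hε1 : ε ≤ 1 / 8) (hκ : |κ| ≤ ε / 2) : |symbolInv ε k 2 - 1 / 9| ≤ 9 * ε := by
  have h0 := symbolInv_two_expansion hk hε hε1 hκ
  have h1 : symbolInv ε k 2 - 1 / 9 =
    (symbolInv ε k 2 - (1 / 9 - 16 / 27 * κ)) - 16 / 27 * κ := by ring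
  rw [h1]
  refine (abs_sub _ _).trans ?_
  rw [abs_mul, abs_of_pos (by norm_num : (0 : ℝ) < 16 / 27)]
  nlinarith

lemma wavenumber_facts {ε ω : ℝ} (hε : 0 < ε) (hε1 : ε ≤ 1 / 8) (hω : |ω| ≤ 1 / 2) :
    |ω * ε| ≤ ε / 2 ∧ √(1 + 2 * ω * ε) ^ 2 = 1 + 2 * (ω * ε) ∧ √(1 + 2 * ω * ε) ≠ 0 ∧
      |√(1 + 2 * ω * ε) ^ 2 - 1| ≤ 1 / 8 := by
  have h1 : |ω * ε| ≤ ε / 2 := by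
    rw [abs_mul, abs_of_pos hε]; nlinarith
  have h2 := abs_le.1 h1
  have h3 : √(1 + 2 * ω * ε) ^ 2 = 1 + 2 * (ω * ε) := by
    rw [Real.sq_sqrt] <;> linarith
  refine ⟨h1, h3, fun h => ?_, ?_⟩
  · rw [h] at h3; linarith
  · rw [h3, abs_le]; constructor <;> linarith

/-- The leading value is D/36 - s²(d₂ - 1/9)/2. The two errors together cost less than half of D/36.
-/
lemma ampl_ge {s D ε A₁ : ℝ} (hD : D = 27 - 2 * s ^ 2) {d lam : ℕ → ℝ}
    (hd : IsInv d lam) (hε : 0 < ε) (hεD : ε ≤ D / 10000) (hd9 : |d 2 - 1 / 9| ≤ 9 * ε)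
    (hR : A₁ * radius s ≤ 1) (hA₁ : 10 * radius s ^ 4 * A₁ ^ 2 ≤ D / 288) (A : ℝ) (w : CosSeq)
    (hA : |A| ≤ A₁) (hw : ‖w‖ ≤ radius s) (fw : step s hd A w = w) : D / 72 ≤ ampl s A w := by
  have hR0 : 0 ≤ radius s := by linarith [radius_ge s]
  have h1 := (abs_le.1 (abs_ampl_sub_leading_le hd (le_trans (by gcongr) hR) hw fw)).1
  have h2 : A ^ 2 ≤ A₁ ^ 2 := by rw [← sq_abs]; gcongr
  have h3 : 10 * radius s ^ 4 * A ^ 2 ≤ 10 * radius s ^ 4 * A₁ ^ 2 := by gcongr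
  have h4 := (abs_le.1 hd9).2
  have h5 : s ^ 2 * (d 2 - 1 / 9) ≤ 27 / 2 * (9 * ε) := by
    calc s ^ 2 * (d 2 - 1 / 9) ≤ s ^ 2 * (9 * ε) := by gcongr
      _ ≤ _ := by gcongr; linarith
  linarith

lemma h6norm_ansatz_le {s : ℝ} {d lam : ℕ → ℝ} (hd : IsInv d lam) {A : ℝ} {w : CosSeq}
    (hA0 : 0 ≤ A) (hA1 : A ≤ 1) (hA : |A| * radius s ≤ 1) (hw : ‖w‖ ≤ radius s)
    (fw : step s hd A w = w) :
    h6norm (toFun (ansatz A w)) ≤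
      √(14 * Real.pi) * (64 + 729 * |s| + 128 * radius s ^ 2) * A := by
  obtain ⟨r, hr, hrn, hsplit⟩ := exists_ansatz_split hd hA hw fw
  have hb : |A ^ 2 * (-(s * d 2 / 2))| ≤ |s| * A := by
    rw [abs_mul, abs_of_nonneg (sq_nonneg A), abs_neg, abs_div, abs_mul, abs_two]
    have h1 : |s| * |d 2| ≤ |s| * (1 / 4) := by gcongr; exact hd.le 2
    have h2 : |s| * |d 2| / 2 ≤ |s| := by linarith [abs_nonneg s]
    have h3 : A ^ 2 ≤ A := by nlinarith
    calc A ^ 2 * (|s| * |d 2| / 2) ≤ A * |s| := by gcongr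
      _ = _ := mul_comm _ _
  have hA3 : A ^ 3 ≤ A := pow_le_of_le_one hA0 hA1 (by norm_num)
  rw [abs_of_nonneg hA0] at hrn
  rw [hsplit]
  calc _ ≤ √(14 * Real.pi) * (64 * |A| + 729 * |A ^ 2 * (-(s * d 2 / 2))| +
        ∑' n : ℕ, (1 + n : ℝ) ^ 6 * |coef n r|) := h6norm_three_le hr _ _
    _ ≤ √(14 * Real.pi) * (64 * A + 729 * (|s| * A) + 128 * radius s ^ 2 * A) := by
        rw [abs_of_nonneg hA0]; gcongr; exact hrn.trans (by gcongr)
    _ = _ := by ring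

/-- Reduces uniqueness among functions to uniqueness among amplitudes. The condition `B ≠ 0` appears
because the mode-one equation carries a factor B. -/
lemma exists_ansatz_of_isEvenProfile {s ε k μ A₁ : ℝ} (hk : k ≠ 0)
    (hd : IsInv (symbolInv ε k) (symbol ε k)) (hlam : symbol ε k 1 = -μ)
    (hA₁R : A₁ * radius s ≤ 1) {v : ℝ → ℝ} (hv : IsEvenProfile ε k s v)
    (hvn : (∑' n : ℕ, 4 / (n : ℝ) ^ 4) * h6norm v ≤ A₁) :
    ∃ B z, |B| ≤ A₁ ∧ ‖z‖ ≤ radius s ∧ step s hd B z = z ∧ v = toFun (ansatz B z) ∧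
      (B ≠ 0 → B ^ 2 * ampl s B z = μ) := by
  have hR0 : 0 ≤ radius s := by linarith [radius_ge s]
  obtain ⟨a, hav, ha0, han⟩ := exists_cosSeq hv.1 hv.2.1 hv.2.2.1
  have haA₁ := han.trans hvn
  have haR : ‖a‖ * radius s ≤ 1 := le_trans (by gcongr) hA₁R
  have hasol : Solves s (symbol ε k) a := solves_of_isEvenProfile hk (by rwa [hav])
  obtain ⟨B, z, hBR, hz, fz, haB⟩ := exists_ansatz hd haR ha0 hasol
  have hBa : |B| ≤ A₁ := by
    have := coef_one_ansatz hd fz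
    rw [← haB] at this
    rw [← this]
    exact (abs_coef_le 1 a).trans haA₁
  rw [haB, solves_ansatz_iff hd fz, hlam] at hasol
  exact ⟨B, z, hBa, hz, fz, by rw [← haB, hav], fun hB =>
    mul_left_cancel₀ hB (by linear_combination hasol)⟩

lemma toFun_ansatz_zero (w : CosSeq) : toFun (ansatz 0 w) = 0 := by
  ext ξ; simp [ansatz]

/-- The difference consists of modes one and two, each with an O(ε³) coefficient, and a remainder of
size |A|³ ≤ (c₀ε)³. No constant depends on ω. -/
lemma h6norm_sub_expansion_le {s D ε ω k A c₀ K : ℝ} (hD : D = 27 - 2 * s ^ 2) (hD0 : 0 < D)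
    (hd : IsInv (symbolInv ε k) (symbol ε k)) (hk : k ^ 2 = 1 + 2 * (ω * ε)) (hε : 0 < ε)
    (hε8 : ε ≤ 1 / 8) (hεD : ε ≤ D / 10000) (hκ : |ω * ε| ≤ ε / 2) (hω : 0 ≤ 1 - 4 * ω ^ 2)
    {w : CosSeq} (hA0 : 0 ≤ A) (hAR : |A| * radius s ≤ 1) (hw : ‖w‖ ≤ radius s)
    (fw : step s hd A w = w) (hh : D / 72 ≤ ampl s A w) (hAc : A ≤ c₀ * ε)
    (hK : K = 4 * s ^ 2 + 10 * radius s ^ 4 * c₀ ^ 2)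
    (heq : A ^ 2 * ampl s A w = ε ^ 2 * √(1 - 4 * ω ^ 2) ^ 2) :
    h6norm (fun ξ => toFun (ansatz A w) ξ - expansion ε ω s ξ) ≤
      √(14 * Real.pi) * (64 * (24 * (50 * (s ^ 2 / D) ^ 2 + 81 * K / D) / √D) +
        729 * (36 * |s| * (4 * (K + 2) + D * 9) / D ^ 2) + 128 * radius s ^ 2 * c₀ ^ 3) *
          ε ^ 3 := by
  have hs2 : s ^ 2 ≤ 27 / 2 := by linarith
  have hm1 : √(1 - 4 * ω ^ 2) ≤ 1 := Real.sqrt_le_one.2 (by linarith [sq_nonneg ω])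
  have hm0 : 0 ≤ √(1 - 4 * ω ^ 2) := Real.sqrt_nonneg _
  obtain ⟨r, hr, hrn, hsplit⟩ := exists_ansatz_split hd hAR hw fw
  have hfun : (fun ξ => toFun (ansatz A w) ξ - expansion ε ω s ξ) =
      toFun ((A - √(1 - 4 * ω ^ 2) * ε * ((6 - 32 * (ω * ε) * s ^ 2 / D) / √D)) • e 1 +
        (A ^ 2 * (-(s * symbolInv ε k 2 / 2)) +
          2 * s * √(1 - 4 * ω ^ 2) ^ 2 / D * ε ^ 2) • e 2 + r) := by
    subst hD
    ext ξ
    rw [expansion_eq hD0 hω, hsplit]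
    simp only [toFun_add, toFun_smul, toFun_e, Nat.cast_one, one_mul, Nat.cast_ofNat]
    ring
  have hd2 := symbolInv_two_expansion hk hε hε8 hκ
  have hd9 := abs_symbolInv_two_sub_le hk hε hε8 hκ
  have hlead := abs_ampl_sub_leading_le hd hAR hw fw
  have hK0 : 0 ≤ K := by rw [hK]; positivity
  have hhK : |ampl s A w - (D / 36 + 8 / 27 * s ^ 2 * (ω * ε))| ≤ K * ε ^ 2 := by
    have h1 : ampl s A w - (D / 36 + 8 / 27 * s ^ 2 * (ω * ε)) =
        (ampl s A w - (3 / 4 - s ^ 2 * symbolInv ε k 2 / 2)) -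
          s ^ 2 / 2 * (symbolInv ε k 2 - (1 / 9 - 16 / 27 * (ω * ε))) := by rw [hD]; ring
    rw [h1]
    refine (abs_sub _ _).trans ?_
    have h3 : |s ^ 2 / 2 * (symbolInv ε k 2 - (1 / 9 - 16 / 27 * (ω * ε)))| ≤
        s ^ 2 / 2 * (8 * ε ^ 2) := by
      rw [abs_mul, abs_of_nonneg (by positivity)]; gcongr
    have h4 : 10 * radius s ^ 4 * A ^ 2 ≤ 10 * radius s ^ 4 * (c₀ * ε) ^ 2 := by gcongr
    calc _ ≤ 10 * radius s ^ 4 * (c₀ * ε) ^ 2 + s ^ 2 / 2 * (8 * ε ^ 2) :=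
          add_le_add (hlead.trans h4) h3
      _ = K * ε ^ 2 := by rw [hK]; ring
  have hhK1 : |ampl s A w - D / 36| ≤ (K + 2) * ε := by
    have h1 : ampl s A w - D / 36 = (ampl s A w - (D / 36 + 8 / 27 * s ^ 2 * (ω * ε))) +
        8 / 27 * s ^ 2 * (ω * ε) := by ring
    rw [h1]
    refine (abs_add_le _ _).trans ?_
    have h2 : |8 / 27 * s ^ 2 * (ω * ε)| ≤ 8 / 27 * (27 / 2) * (ε / 2) := by
      rw [abs_mul, abs_of_nonneg (by positivity)]; gcongr
    have h3 : K * ε ^ 2 ≤ K * ε := by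
      gcongr; exact pow_le_of_le_one hε.le (by linarith) two_ne_zero
    linarith
  have hx : 32 * |ω * ε| * s ^ 2 ≤ 3 * D := by
    calc 32 * |ω * ε| * s ^ 2 ≤ 32 * (ε / 2) * (27 / 2) := by gcongr
      _ ≤ 3 * D := by linarith
  have hα := abs_amplitude_sub_le hD0 hε hκ hx hm0 hm1 hA0 hh hhK heq
  have hβ := abs_second_mode_sub_le (s := s) hD0 hε hm0 hm1 hh hhK1 hd9 heq
  rw [abs_of_nonneg hA0] at hrn
  have hr3 : ∑' n : ℕ, (1 + n : ℝ) ^ 6 * |coef n r| ≤ 128 * radius s ^ 2 * (c₀ * ε) ^ 3 :=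
    hrn.trans (by gcongr)
  rw [hfun]
  refine (h6norm_three_le hr _ _).trans ?_
  refine (mul_le_mul_of_nonneg_left ?_ (Real.sqrt_nonneg _)).trans_eq (mul_assoc _ _ _).symm
  linarith

end CosSeq

end PatternCL

end

/-! ### The existence theorem -/

theorem theorem1p1 (s : ℝ) (hs : s ∈ Set.Ioo (-√(27 / 2 : ℝ)) (√(27 / 2 : ℝ))) :
    ∃ ε₀ > (0 : ℝ), ∃ δ > (0 : ℝ), ∃ C : ℝ,
      ∀ ε ∈ Set.Ioo 0 ε₀, ∀ ω ∈ Set.Icc (-(1 / 2) : ℝ) (1 / 2),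
        ∃ u : ℝ → ℝ,
          -- a small even solution, positive at `0` (away from the end points `ω = ±1/2`)
          (PatternCL.IsEvenProfile ε (√(1 + 2 * ω * ε)) s u ∧ PatternCL.h6norm u < δ ∧
            (|ω| < 1 / 2 → 0 < u 0)) ∧
          -- the only one
          (∀ v : ℝ → ℝ, PatternCL.IsEvenProfile ε (√(1 + 2 * ω * ε)) s v →
            PatternCL.h6norm v < δ → (|ω| < 1 / 2 → 0 < v 0) → v = u) ∧
          -- the zero solution at the end points
          (|ω| = 1 / 2 → u = 0) ∧
          -- the expansion, uniformly in `ω`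
          PatternCL.h6norm (fun ξ => u ξ - PatternCL.expansion ε ω s ξ) ≤ C * ε ^ 3 := by
  have hs2 : s ^ 2 < 27 / 2 := by
    rw [← sq_abs]
    calc |s| ^ 2 < √(27 / 2 : ℝ) ^ 2 := by
          gcongr
          exact abs_lt.2 hs
      _ = 27 / 2 := Real.sq_sqrt (by norm_num)
  obtain ⟨D, hD⟩ : ∃ D, D = 27 - 2 * s ^ 2 := ⟨_, rfl⟩
  have hD0 : 0 < D := by linarith
  have hD27 : D ≤ 27 := by linarith [sq_nonneg s]
  have hR0 : 0 < PatternCL.CosSeq.radius s := by linarith [PatternCL.CosSeq.radius_ge s]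
  obtain ⟨A₁, hA₁0, hA₁1, hA₁R, hA₁4, hA₁3⟩ :=
    PatternCL.CosSeq.exists_amplitude_bound s hD0 hD27
  obtain ⟨C₆, hC₆⟩ : ∃ C₆, C₆ = ∑' n : ℕ, 4 / (n : ℝ) ^ 4 := ⟨_, rfl⟩
  have hC₆0 : 0 ≤ C₆ := hC₆ ▸ tsum_nonneg fun n => by positivity
  -- Norm below δ in `H⁶` forces coefficient norm at most A₁; the 1 avoids a separate positivity
  -- proof for `C₆`.
  obtain ⟨δ, hδ⟩ : ∃ δ, δ = A₁ / (C₆ + 1) := ⟨_, rfl⟩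
  have hδ0 : 0 < δ := hδ ▸ by positivity
  have hδA : (C₆ + 1) * δ = A₁ := by rw [hδ]; field_simp
  -- From h ≥ D/72 and A²h ≤ ε² follows A ≤ c₀ε.
  obtain ⟨c₀, hc₀⟩ : ∃ c₀, c₀ = √(72 / D) := ⟨_, rfl⟩
  have hc₀0 : 0 ≤ c₀ := hc₀ ▸ Real.sqrt_nonneg _
  have hc₀2 : c₀ ^ 2 * (D / 72) = 1 := by
    rw [hc₀, Real.sq_sqrt (by positivity)]; field_simp
  obtain ⟨K, hK⟩ : ∃ K, K = 4 * s ^ 2 + 10 * PatternCL.CosSeq.radius s ^ 4 * c₀ ^ 2 := ⟨_, rfl⟩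
  obtain ⟨Q, hQ⟩ : ∃ Q, Q = √(14 * Real.pi) *
    (64 + 729 * |s| + 128 * PatternCL.CosSeq.radius s ^ 2) := ⟨_, rfl⟩
  have hQ0 : 0 ≤ Q := hQ ▸ by positivity
  -- The first bound puts ε²(1 - 4ω²) in the range reached on [0, A₁] and makes ε small against D;
  -- the second keeps the solution's norm, at most Qc₀ε, below δ.
  refine ⟨min (A₁ * (D / 1000)) (δ / (Q * c₀ + 1)), by positivity, δ, hδ0,
    √(14 * Real.pi) * (64 * (24 * (50 * (s ^ 2 / D) ^ 2 + 81 * K / D) / √D) +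
      729 * (36 * |s| * (4 * (K + 2) + D * 9) / D ^ 2) +
      128 * PatternCL.CosSeq.radius s ^ 2 * c₀ ^ 3), ?_⟩
  rintro ε ⟨hε0, hε⟩ ω ⟨hω1, hω2⟩
  have hεA : ε < A₁ * (D / 1000) := lt_of_lt_of_le hε (min_le_left _ _)
  have hεδ : ε * (Q * c₀ + 1) < δ :=
    (lt_div_iff₀ (by positivity)).1 (lt_of_lt_of_le hε (min_le_right _ _))
  have hεD : ε ≤ D / 10000 := by
    have : A₁ * (D / 1000) ≤ 1 / 100 * (D / 1000) := by gcongr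
    linarith
  have hε8 : ε ≤ 1 / 8 := by linarith
  have hωa : |ω| ≤ 1 / 2 := abs_le.2 ⟨hω1, hω2⟩
  have hω4 : 0 ≤ 1 - 4 * ω ^ 2 := by
    have : |ω| ^ 2 ≤ (1 / 2) ^ 2 := by gcongr
    rw [sq_abs] at this
    linarith
  obtain ⟨hκ, hk2, hk0, hk8⟩ := PatternCL.CosSeq.wavenumber_facts hε0 hε8 hωa
  -- From here on only k² = 1 + 2ωε, its closeness to 1 and k ≠ 0 matter.
  generalize √(1 + 2 * ω * ε) = k at hk2 hk0 hk8 ⊢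
  have hinv := PatternCL.CosSeq.isInv_symbolInv hk8 (pow_le_one₀ hε0.le (by linarith) : ε ^ 2 ≤ 1)
  have hd9 := PatternCL.CosSeq.abs_symbolInv_two_sub_le hk2 hε0 hε8 hκ
  obtain ⟨m, hm⟩ : ∃ m, m = √(1 - 4 * ω ^ 2) := ⟨_, rfl⟩
  have hm0 : 0 ≤ m := hm ▸ Real.sqrt_nonneg _
  have hm2 : m ^ 2 = 1 - 4 * ω ^ 2 := by rw [hm, Real.sq_sqrt hω4]
  have hm1 : m ^ 2 ≤ 1 := by linarith [sq_nonneg ω]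
  have hlam1 : PatternCL.CosSeq.symbol ε k 1 = -(ε ^ 2 * m ^ 2) := by
    rw [PatternCL.CosSeq.symbol, hk2, hm2]; push_cast; ring
  have hge := PatternCL.CosSeq.ampl_ge hD hinv hε0 hεD hd9 hA₁R.le hA₁4
  have hμ : ε ^ 2 * m ^ 2 ≤ A₁ ^ 2 * (D / 72) := by
    have h3 : (D / 1000) ^ 2 ≤ D / 72 := by
      rw [sq]
      have : D / 1000 * (D / 1000) ≤ 1 * (D / 1000) := by gcongr; linarith
      linarith
    calc ε ^ 2 * m ^ 2 ≤ (A₁ * (D / 1000)) ^ 2 * 1 := by gcongr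
      _ = A₁ ^ 2 * (D / 1000) ^ 2 := by ring
      _ ≤ _ := by gcongr
  obtain ⟨A, w, hA0, hA1, hw, fw, heq⟩ :=
    PatternCL.CosSeq.exists_amplitude s hinv hA₁0.le hA₁R.le hge (by positivity) hμ
  have hAabs : |A| = A := abs_of_nonneg hA0
  have hAR : |A| * PatternCL.CosSeq.radius s < 1 :=
    lt_of_le_of_lt (by rw [hAabs]; gcongr) hA₁R
  have hh := hge A w (hAabs.le.trans hA1) hw fw
  have hh0 : 0 < PatternCL.CosSeq.ampl s A w := lt_of_lt_of_le (by positivity) hh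
  have hAc : A ≤ c₀ * ε := by
    refine le_of_sq_le_sq ?_ (by positivity)
    have h1 : A ^ 2 * (D / 72) ≤ A ^ 2 * PatternCL.CosSeq.ampl s A w := by gcongr
    have h2 : ε ^ 2 * m ^ 2 ≤ ε ^ 2 * 1 := by gcongr
    refine le_of_mul_le_mul_right ?_ (by positivity : 0 < D / 72)
    rw [mul_pow, mul_right_comm, hc₀2]
    linarith
  have hsmooth : (PatternCL.CosSeq.ansatz A w).Smooth := by
    obtain ⟨r, hr, -, hsplit⟩ := PatternCL.CosSeq.exists_ansatz_split hinv hAR.le hw fw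
    rw [hsplit]
    exact PatternCL.CosSeq.smooth_three hr _ _
  have hsolves := (PatternCL.CosSeq.solves_ansatz_iff hinv fw).2
    (by rw [hlam1]; linear_combination A * heq)
  have hprof := PatternCL.CosSeq.isEvenProfile_of_solves hk0 hsmooth
    (PatternCL.CosSeq.coef_zero_ansatz hinv fw) hsolves
  have hApos : |ω| < 1 / 2 → 0 < A := fun h => by
    have hmp : 0 < m := by
      rw [hm]
      refine Real.sqrt_pos.2 ?_
      have : |ω| ^ 2 < (1 / 2) ^ 2 := by gcongr
      rw [sq_abs] at this
      linarith
    refine lt_of_le_of_ne hA0 fun h0 => ?_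
    rw [← h0] at heq
    have : 0 < ε ^ 2 * m ^ 2 := by positivity
    linarith
  have hmzero : |ω| = 1 / 2 → m ^ 2 = 0 := fun h => by
    rw [hm2, ← sq_abs, h]; norm_num
  have hAzero : |ω| = 1 / 2 → A = 0 := fun h => by
    rw [hmzero h, mul_zero] at heq
    exact pow_eq_zero_iff two_ne_zero |>.1 ((mul_eq_zero.1 heq).resolve_right hh0.ne')
  refine ⟨PatternCL.CosSeq.toFun (PatternCL.CosSeq.ansatz A w), ⟨hprof, ?_, fun h => ?_⟩, ?_,
    fun h => ?_, ?_⟩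
  · refine (PatternCL.CosSeq.h6norm_ansatz_le hinv hA0 (by linarith) hAR.le hw fw).trans_lt ?_
    rw [← hQ]
    have : Q * A ≤ Q * (c₀ * ε) := by gcongr
    linarith
  · exact (PatternCL.CosSeq.toFun_ansatz_zero_sign hAR hw).1 (hApos h)
  · intro v hv hvδ hv0
    have hvn : C₆ * PatternCL.h6norm v ≤ A₁ := by
      have := mul_le_mul_of_nonneg_left hvδ.le hC₆0
      linarith
    obtain ⟨B, z, hBa, hz, fz, rfl, hBeq⟩ :=
      PatternCL.CosSeq.exists_ansatz_of_isEvenProfile hk0 hinv hlam1 hA₁R.le hv (hC₆ ▸ hvn)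
    have hBR : |B| * PatternCL.CosSeq.radius s < 1 := lt_of_le_of_lt (by gcongr) hA₁R
    rcases hωa.lt_or_eq with hlt | hωe
    · have hv0' := hv0 hlt
      have hBpos : 0 < B := by
        rcases lt_trichotomy B 0 with h | h | h
        · exact absurd hv0' ((PatternCL.CosSeq.toFun_ansatz_zero_sign hBR hz).2 h).not_gt
        · rw [h, PatternCL.CosSeq.toFun_ansatz_zero] at hv0'
          exact absurd hv0' (lt_irrefl _)
        · exact h
      have hBA : A = B := PatternCL.CosSeq.amplitude_unique hinv hA₁R.le hA₁3
        (hApos hlt) hBpos hA1 ((le_abs_self B).trans hBa) hw hz fw fz hh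
        (by rw [heq, hBeq hBpos.ne'])
      subst hBA
      have hwz := PatternCL.CosSeq.norm_fixedPoint_sub_le hinv hAR.le hAR.le hw hz fw fz
      rw [sub_self, abs_zero, mul_zero] at hwz
      rw [sub_eq_zero.1 (norm_le_zero_iff.1 hwz)]
    · have hB0 : B = 0 := by
        by_contra hB
        have h1 := hBeq hB
        rw [hmzero hωe, mul_zero] at h1
        have : 0 < B ^ 2 * PatternCL.CosSeq.ampl s B z :=
          mul_pos (by positivity) (lt_of_lt_of_le (by positivity) (hge B z hBa hz fz))
        exact this.ne' h1
      rw [hB0, hAzero hωe, PatternCL.CosSeq.toFun_ansatz_zero, PatternCL.CosSeq.toFun_ansatz_zero]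
  · rw [hAzero h, PatternCL.CosSeq.toFun_ansatz_zero]
  · exact PatternCL.CosSeq.h6norm_sub_expansion_le hD hD0 hinv hk2 hε0 hε8 hεD hκ hω4 hA0 hAR.le hw
      fw hh hAc hK (hm ▸ heq)
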